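/- **Setting.** Let $d\ge 0$, let $P$ be a probability distribution on a sample space $\Xi$ (e.g. the uniform distribution on a finite dataset, or on its minibatches), let $f(x,\xi)$ be a loss in $x\in\mathbb R^d$, $\xi\in\Xi$, with $f(x,\cdot)$ $P$-integrable, and let $f(x)=\mathbb E_{\xi\sim P}f(x,\xi)$. Gradients are taken in $x$; $z_l$ is the $l$-th coordinate of $z$, and $\|z\|_1=\sum_l|z_l|$. **Algorithm (LightSAM-III).** Start from $x_1\in\mathbb R^d$, $r_0=m_0=0$ and $u_0=v_0=(\epsilon^2,\dots,\epsilon^2)$ with $\epsilon>0$. For $t=1,\dots,T$, draw $\xi_t\sim P$ independently of the past and, with all products, quotients and roots of vectors taken coordinate-wise, set $$s_t=\nabla f(x_t,\xi_t),\quad r_t=\beta_1r_{t-1}+(1-\beta_1)s_t,\quad u_t=\beta_2u_{t-1}+(1-\beta_2)s_t^2,\quad w_t=x_t+\rho\,\frac{r_t}{\sqrt{u_t}},$$ $$g_t=\nabla f(w_t,\xi_t),\quad m_t=\beta_1m_{t-1}+(1-\beta_1)g_t,\quad v_t=\beta_2v_{t-1}+(1-\beta_2)g_t^2,\quad x_{t+1}=x_t-\eta\,\frac{m_t}{\sqrt{v_t}}.$$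 **Assumptions on $f$.** * $f$ is bounded below, with $f(x_1)-\inf f\le\Delta$. * Each $f(\cdot,\xi)$ is differentiable and $|\nabla f(x,\xi)_l-\nabla f(y,\xi)_l|\le L|x_l-y_l|$ for all $x,y,\xi,l$. * There are constants $D_0,D_1>0$ with $\mathbb E_{\xi\sim P}\nabla f(x,\xi)_l^2\le D_0+D_1\nabla f(x)_l^2$ for all $x,l$ (in particular the left side is finite). **Assumptions on the hyper-parameters.** * $0\le\beta_1<\sqrt{\beta_2}<1$ and $\beta_2\ge\frac12\big(\sqrt{D_3^2+4D_3}-D_3\big)$, where $$D_3=\max\Big\{4\sqrt{\beta_2},\ \frac{256\sqrt{\beta_2}D_1}{\beta_2-\beta_1^2},\ \frac{2048\sqrt{C_1}D_1\rho}{(1-\beta_1)(1-\beta_1^2/\beta_2)\sqrt{\beta_2}\,\eta}\Big(1+\frac{2D_1}{\beta_2-\beta_1^2}\Big)\Big\},$$ $$C_1=\max\Big\{1,\ 2(1-\beta_2)\Big[1+\frac{(1-\beta_1)^2\rho^2L^2}{(1-\beta_1^a)(1-\beta_2^b)\epsilon^2}\Big]\Big\}$$ for some $a,b\in(0,2)$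 with $\beta_1^{2-a}\le\beta_2^{1+b}$. * $1-\beta_2\le C_\beta T^{-1}$, $\ c_\eta T^{-1/2}\le\eta\le C_\eta T^{-1/2}$ and $0\le\rho\le C_\rho T^{-1/2}$, with constants $C_\beta,c_\eta,C_\eta,C_\rho$ not depending on $T$ and $c_\eta>0$. **Conclusion.** There is a constant $K$, depending only on $d,L,D_0,D_1,\epsilon,\beta_1,\Delta,C_\beta,c_\eta,C_\eta,C_\rho$, such that for every $T\ge2$ all the expectations below are finite and $$\frac1T\sum_{t=1}^T\mathbb E\|\nabla f(x_t)\|_1\le K\,\frac{\ln T}{T^{1/4}} .$$ -/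

import Mathlib

open MeasureTheory ProbabilityTheory

noncomputable section

namespace LightSAM

/-- The weight space `ℝ^d`. -/
abbrev Vec (d : ℕ) : Type := EuclideanSpace ℝ (Fin d)

/-- The `ℓ₁` norm. -/
def l1norm {d : ℕ} (x : Vec d) : ℝ := ∑ l, |x l|

/-- The stochastic gradient `∇f(x, ξ)` (gradient in `x`) of the sample loss `F x ξ = f(x, ξ)`. -/
def stochGrad {d : ℕ} {Ξ : Type*} (F : Vec d → Ξ → ℝ) (x : Vec d) (ξ : Ξ) : Vec d :=
  gradient (fun y => F y ξ) x

/-- The objective `f(x) = E_{ξ ∼ P} f(x, ξ)`. For a dataset `ξ_1, …, ξ_n` and the uniform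
distribution `P` on it this is `(1/n) ∑ i, f(x, ξ_i)`; minibatch sampling is the case in which
`Ξ` is the set of minibatches. -/
def objective {d : ℕ} {Ξ : Type*} [MeasurableSpace Ξ] (F : Vec d → Ξ → ℝ) (P : Measure Ξ)
    (x : Vec d) : ℝ :=
  ∫ ξ, F x ξ ∂P

/-- Coordinate-wise `L`-smoothness of the sample losses. -/
def CoordSmooth {d : ℕ} {Ξ : Type*} (F : Vec d → Ξ → ℝ) (L : ℝ) : Prop :=
  (∀ ξ, Differentiable ℝ (fun x => F x ξ)) ∧
    ∀ (ξ : Ξ) (x y : Vec d) (l : Fin d),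
      |stochGrad F x ξ l - stochGrad F y ξ l| ≤ L * |x l - y l|

/-- Coordinate-wise affine noise variance: a fresh sample `ξ ∼ P` satisfies
`E ∇f(x, ξ)_l² ≤ D₀ + D₁ ∇f(x)_l²` (the second moment being finite). -/
def CoordAffineNoise {d : ℕ} {Ξ : Type*} [MeasurableSpace Ξ] (F : Vec d → Ξ → ℝ)
    (P : Measure Ξ) (D₀ D₁ : ℝ) : Prop :=
  ∀ (x : Vec d) (l : Fin d),
    Integrable (fun ξ => (stochGrad F x ξ l) ^ 2) P ∧
      ∫ ξ, (stochGrad F x ξ l) ^ 2 ∂P ≤ D₀ + D₁ * (gradient (objective F P) x l) ^ 2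

/-- The variables kept by LightSAM-III between iterations: the weights `x`, the first and second
moments `r, u` of the perturbation step and `m, v` of the update step. -/
structure State (d : ℕ) where
  x : Vec d
  r : Vec d
  u : Vec d
  m : Vec d
  v : Vec d

/-- Initialization: `r = m = 0` and every coordinate of `u` and `v` is `ε²`. -/
def State.init {d : ℕ} (ε : ℝ) (x₁ : Vec d) : State d where
  x := x₁
  r := 0
  u := WithLp.toLp 2 fun _ => ε ^ 2
  m := 0
  v := WithLp.toLp 2 fun _ => ε ^ 2

/-- One iteration of LightSAM-III (Adam) with the sample `ξ`. -/
def State.step {d : ℕ} {Ξ : Type*} (F : Vec d → Ξ → ℝ) (β₁ β₂ η ρ : ℝ)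
    (S : State d) (ξ : Ξ) : State d :=
  let s : Vec d := stochGrad F S.x ξ
  let r : Vec d := β₁ • S.r + (1 - β₁) • s
  let u : Vec d := WithLp.toLp 2 fun l => β₂ * S.u l + (1 - β₂) * (s l * s l)
  let w : Vec d := WithLp.toLp 2 fun l => S.x l + ρ * (1 / √(u l) * r l)
  let g : Vec d := stochGrad F w ξ
  let m : Vec d := β₁ • S.m + (1 - β₁) • g
  let v : Vec d := WithLp.toLp 2 fun l => β₂ * S.v l + (1 - β₂) * (g l * g l)
  { x := WithLp.toLp 2 fun l => S.x l - η * (1 / √(v l) * m l)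
    r := r
    u := u
    m := m
    v := v }

/-- The state after `t` iterations of LightSAM-III along the samples `ξ 0, ξ 1, …`
(`ξ t` is the sample of iteration `t + 1`). -/
def run {d : ℕ} {Ξ : Type*} (F : Vec d → Ξ → ℝ) (β₁ β₂ η ρ ε : ℝ) (x₁ : Vec d)
    (ξ : ℕ → Ξ) : ℕ → State d
  | 0 => State.init ε x₁
  | t + 1 => (run F β₁ β₂ η ρ ε x₁ ξ t).step F β₁ β₂ η ρ (ξ t)

/-- The weights after `t` iterations, i.e. the iterate `x_{t+1}`. -/
def weights {d : ℕ} {Ξ : Type*} (F : Vec d → Ξ → ℝ) (β₁ β₂ η ρ ε : ℝ) (x₁ : Vec d)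
    (ξ : ℕ → Ξ) (t : ℕ) : Vec d :=
  (run F β₁ β₂ η ρ ε x₁ ξ t).x

/-- The constant `C₁` (with auxiliary exponents `a, b`) that enters `D₃`. -/
def C₁ (β₁ β₂ ρ L ε a b : ℝ) : ℝ :=
  max 1 (2 * (1 - β₂) *
    (1 + (1 - β₁) ^ 2 * ρ ^ 2 * L ^ 2 / ((1 - β₁ ^ a) * (1 - β₂ ^ b) * ε ^ 2)))

/-- The constant `D₃` of the lower bound on `β₂`. -/
def D₃ (β₁ β₂ η ρ L ε D₁ a b : ℝ) : ℝ :=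
  max (4 * √β₂)
    (max (256 * √β₂ * D₁ / (β₂ - β₁ ^ 2))
      (2048 * √(C₁ β₁ β₂ ρ L ε a b) * D₁ * ρ /
          ((1 - β₁) * (1 - β₁ ^ 2 / β₂) * √β₂ * η) *
        (1 + 2 * D₁ / (β₂ - β₁ ^ 2))))

end LightSAM

end

open LightSAM

set_option linter.unusedSectionVars false

namespace LightSAM

/-! Coordinate-wise smoothness forces `∇f(x, ξ)_l` to depend on `x_l` only (`stochGrad_apply_eq`),
so each coordinate of the algorithm is a scalar stochastic descent of its own and the bounds are
summed over `l` at the end.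

In one coordinate Adam is turned into AdaGrad with momentum. Dividing `v_t` by `β₂ ^ t`, and `m_t`
by `√β₂ ^ t`, leaves the iterates unchanged, makes the second moment a running sum and hence the
stepsize `a_t = 1 / √V_t` nonincreasing, and replaces the momentum factor by `γ = β₁ / √β₂`. Since
`1 - β₂ = O(1 / T)`, all rescaling factors up to time `T` are bounded. Every constant is absorbed
into one number `A`, and `η`, `ρ` are `O(θ)` with `θ = 1 / √T`.

The descent inequality (`descent_step`) is applied to the shifted points `x_t - η γ / (1 - γ) m_t
a_t`, with the predictable stepsize `a_t`, which does not see the current sample. The error carries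
the factor `a_t - a_{t+1}`. Young's inequality with weight `σ_t = D₀ + D₁ h(x_t) ^ 2`, where `h` is
the partial derivative of the objective, splits it into `σ_t (a_t - a_{t+1})`, which sums by parts,
and `normalized`, whose expectation is at most `E h(x_t) ^ 2 a_t` and is absorbed by the descent
term. What remains is `θ ^ 2` times the sum of the energies.

The final function gap controls `h(x_N) ^ 2`, and the expected energies are controlled by bounds on
`E h(x_t) ^ 2`. A discrete Gronwall argument (`second_moment_gradient`) therefore bounds these
second moments uniformly for `t ≤ T`, because `θ ^ 2 T = 1`. It follows that `θ ∑ E h(x_t) ^ 2 a_t`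
and `E V_t` are bounded, and Young's inequality `|h| ≤ τ h ^ 2 a + (1 + V) / τ` with `τ = T ^ (1 /
4)` yields the rate `T ^ (-1 / 4)`. The logarithm in the conclusion is then only a factor bounded
below. -/

/-! ### Exponentially decayed sums and smooth scalar functions -/

/-- The exponentially decayed sum `∑_{k < t} γ ^ (t - 1 - k) * f k`. -/
noncomputable def decayedSum (γ : ℝ) (f : ℕ → ℝ) : ℕ → ℝ
  | 0 => 0
  | t + 1 => γ * decayedSum γ f t + f t

lemma decayedSum_nonneg {γ : ℝ} {f : ℕ → ℝ} (hγ : 0 ≤ γ) (hf : ∀ t, 0 ≤ f t) (t : ℕ) :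
    0 ≤ decayedSum γ f t := by
  induction t with
  | zero => exact le_rfl
  | succ t ih => exact add_nonneg (mul_nonneg hγ ih) (hf t)

/-- Summing the recursion over time: a decayed sum costs at most a factor `1 / (1 - γ)` in total. -/
lemma sum_decayedSum_add (γ : ℝ) (f : ℕ → ℝ) (N : ℕ) :
    (1 - γ) * ∑ t ∈ Finset.range N, decayedSum γ f (t + 1) + γ * decayedSum γ f N
      = ∑ t ∈ Finset.range N, f t := by
  induction N with
  | zero => simp [decayedSum]
  | succ N ih =>
    rw [Finset.sum_range_succ, Finset.sum_range_succ, ← ih]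
    simp only [decayedSum]
    ring

lemma sum_decayedSum_le {γ A : ℝ} {f : ℕ → ℝ} (hγ : 0 ≤ γ) (hA : 0 ≤ A)
    (hAγ : 1 ≤ A * (1 - γ)) (hf : ∀ t, 0 ≤ f t) (N : ℕ) :
    ∑ t ∈ Finset.range N, decayedSum γ f (t + 1) ≤ A * ∑ t ∈ Finset.range N, f t := by
  have h := sum_decayedSum_add γ f N
  have hD := mul_nonneg hγ (decayedSum_nonneg hγ hf N)
  have hS : 0 ≤ ∑ t ∈ Finset.range N, decayedSum γ f (t + 1) :=
    Finset.sum_nonneg fun t _ => decayedSum_nonneg hγ hf (t + 1)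
  calc ∑ t ∈ Finset.range N, decayedSum γ f (t + 1)
      ≤ A * (1 - γ) * ∑ t ∈ Finset.range N, decayedSum γ f (t + 1) :=
        le_mul_of_one_le_left hS hAγ
    _ = A * ((1 - γ) * ∑ t ∈ Finset.range N, decayedSum γ f (t + 1)) := by ring
    _ ≤ A * ∑ t ∈ Finset.range N, f t := by gcongr; linarith

/-- Mean value inequality for `φ` minus its linear part, whose derivative is at most `A * |z - y|`
on the segment. Losing the factor 1/2 of the Taylor bound is harmless. -/
lemma abs_sub_linear_le {φ h : ℝ → ℝ} {A : ℝ} (hφ : ∀ x, HasDerivAt φ (h x) x)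
    (hh : ∀ x y, |h x - h y| ≤ A * |x - y|) (hA : 0 ≤ A) (y z : ℝ) :
    |φ z - φ y - h y * (z - y)| ≤ A * (z - y) ^ 2 := by
  have key := (convex_uIcc y z).norm_image_sub_le_of_norm_hasDerivWithin_le
    (f := fun t => φ t - h y * t) (f' := fun t => h t - h y) (C := A * |z - y|) (x := y) (y := z)
    (fun t _ => by
      have := (hφ t).fun_sub ((hasDerivAt_id t).const_mul (h y))
      simpa using this.hasDerivWithinAt)
    (fun t ht => by
      rw [Real.norm_eq_abs]
      refine (hh t y).trans ?_
      exact mul_le_mul_of_nonneg_left (Set.abs_sub_left_of_mem_uIcc ht) hA)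
    Set.left_mem_uIcc Set.right_mem_uIcc
  rw [Real.norm_eq_abs, Real.norm_eq_abs, mul_assoc, ← sq, sq_abs] at key
  convert key using 2
  ring

/-- A gradient step of length `1 / (2 * A)` lowers `φ` by at least `h y ^ 2 / (4 * A)`, and `φ`
cannot fall below `c - Δ`. -/
lemma sq_deriv_le {φ h : ℝ → ℝ} {A Δ c : ℝ} (hφ : ∀ x, HasDerivAt φ (h x) x)
    (hh : ∀ x y, |h x - h y| ≤ A * |x - y|) (hA : 0 < A) (hb : ∀ y, c - φ y ≤ Δ) (y : ℝ) :
    h y ^ 2 ≤ 4 * A * (φ y - c + Δ) := by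
  have h1 := (abs_le.1 (abs_sub_linear_le hφ hh hA.le y (y - h y / (2 * A)))).2
  have h2 := hb (y - h y / (2 * A))
  have e : h y * (y - h y / (2 * A) - y) + A * (y - h y / (2 * A) - y) ^ 2
      = - (h y ^ 2 / (4 * A)) := by field_simp; ring
  have h3 : h y ^ 2 / (4 * A) ≤ φ y - c + Δ := by linarith
  rwa [div_le_iff₀ (by positivity), mul_comm] at h3

/-! ### Deterministic scalar paths: the momentum cross term -/

/-- A path of AdaGrad-like descent with momentum: `x` are the iterates, `s` the stochastic
gradients at them, `g` the rescaled perturbed gradients, `m` their momentum, `a` the adaptive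
stepsizes and `r` the perturbations. All constants are controlled by `A`, and `η` and the
perturbation size by `A * θ`. -/
structure IsPath (A θ η γ β D₀ D₁ : ℝ) (T : ℕ) (h : ℝ → ℝ) (b x s r g m a : ℕ → ℝ) : Prop where
  one_le_A : 1 ≤ A
  θ_nonneg : 0 ≤ θ
  θ_le : θ ≤ 1
  η_nonneg : 0 ≤ η
  η_le : η ≤ A * θ
  β_nonneg : 0 ≤ β
  β_le : β ≤ γ
  gap : 1 ≤ A * (1 - γ)
  D₀_pos : 0 < D₀
  D₀_le : D₀ ≤ A
  D₁_nonneg : 0 ≤ D₁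
  D₁_le : D₁ ≤ A
  lip : ∀ x y, |h x - h y| ≤ A * |x - y|
  one_le_b : ∀ t < T, 1 ≤ b t
  b_le : ∀ t < T, b t ≤ A
  m_zero : m 0 = 0
  m_succ : ∀ t, m (t + 1) = γ * m t + (1 - β) * g t
  x_succ : ∀ t, x (t + 1) = x t - η * (m (t + 1) * a (t + 1))
  a_nonneg : ∀ t, 0 ≤ a t
  a_le : ∀ t, a t ≤ A
  a_anti : ∀ t, a (t + 1) ≤ a t
  g_sub : ∀ t < T, |g t - b t * s t| ≤ A ^ 5 * θ * |r t|

/-- The squared size of the quantities of step `t`. -/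
noncomputable def energy (γ : ℝ) (h : ℝ → ℝ) (x r g : ℕ → ℝ) (t : ℕ) : ℝ :=
  h (x t) ^ 2 + decayedSum γ (fun k => |g k|) (t + 1) ^ 2 + r t ^ 2

/-- The normalized second moment of step `t`. -/
noncomputable def normalized (D₀ D₁ : ℝ) (h : ℝ → ℝ) (x s a : ℕ → ℝ) (t : ℕ) : ℝ :=
  h (x t) ^ 2 * s t ^ 2 / (D₀ + D₁ * h (x t) ^ 2) * a t

lemma energy_nonneg (γ : ℝ) (h : ℝ → ℝ) (x r g : ℕ → ℝ) (t : ℕ) : 0 ≤ energy γ h x r g t := by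
  unfold energy; positivity

namespace IsPath

variable {A θ η γ β D₀ D₁ : ℝ} {T : ℕ} {h : ℝ → ℝ} {b x s r g m a : ℕ → ℝ}

lemma A_pos (p : IsPath A θ η γ β D₀ D₁ T h b x s r g m a) : 0 < A :=
  zero_lt_one.trans_le p.one_le_A

lemma γ_nonneg (p : IsPath A θ η γ β D₀ D₁ T h b x s r g m a) : 0 ≤ γ :=
  p.β_nonneg.trans p.β_le

lemma γ_lt_one (p : IsPath A θ η γ β D₀ D₁ T h b x s r g m a) : γ < 1 := by
  have := p.gap
  have := p.A_pos
  by_contra hc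
  nlinarith

lemma inv_gap_le (p : IsPath A θ η γ β D₀ D₁ T h b x s r g m a) : 1 / (1 - γ) ≤ A := by
  rw [div_le_iff₀ (by linarith [p.γ_lt_one])]
  exact p.gap

lemma decayed_nonneg (p : IsPath A θ η γ β D₀ D₁ T h b x s r g m a) (t : ℕ) :
    0 ≤ decayedSum γ (fun k => |g k|) t :=
  decayedSum_nonneg p.γ_nonneg (fun _ => abs_nonneg _) t

lemma normalized_nonneg (p : IsPath A θ η γ β D₀ D₁ T h b x s r g m a) (t : ℕ) :
    0 ≤ normalized D₀ D₁ h x s a t := by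
  have h0 := p.D₀_pos
  have h1 := p.D₁_nonneg
  have h2 := p.a_nonneg t
  unfold normalized; positivity

lemma abs_m_le (p : IsPath A θ η γ β D₀ D₁ T h b x s r g m a) (t : ℕ) :
    |m t| ≤ decayedSum γ (fun k => |g k|) t := by
  induction t with
  | zero => simp [p.m_zero, decayedSum]
  | succ t ih =>
    have hγ := p.γ_nonneg
    have h1 := p.γ_lt_one
    have h2 := p.β_nonneg
    have h3 := p.β_le
    rw [p.m_succ]
    refine (abs_add_le _ _).trans ?_
    rw [abs_mul, abs_mul, abs_of_nonneg hγ, abs_of_nonneg (by linarith : 0 ≤ 1 - β)]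
    simp only [decayedSum]
    gcongr
    exact mul_le_of_le_one_left (abs_nonneg _) (by linarith)

lemma sq_decayed_le_energy (t : ℕ) :
    decayedSum γ (fun k => |g k|) (t + 1) ^ 2 ≤ energy γ h x r g t := by
  unfold energy; linarith [sq_nonneg (h (x t)), sq_nonneg (r t)]

lemma abs_h_succ_sub_le (p : IsPath A θ η γ β D₀ D₁ T h b x s r g m a) (t : ℕ) :
    |h (x (t + 1)) - h (x t)| ≤ A ^ 3 * θ * decayedSum γ (fun k => |g k|) (t + 1) := by
  have hA := p.A_pos
  have h1 := p.η_nonneg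
  have h2 := p.a_nonneg (t + 1)
  have h3 := p.θ_nonneg
  have hM := p.decayed_nonneg (t + 1)
  refine (p.lip _ _).trans ?_
  have e : x (t + 1) - x t = - (η * (m (t + 1) * a (t + 1))) := by rw [p.x_succ]; ring
  rw [e, abs_neg, abs_mul, abs_mul, abs_of_nonneg h1, abs_of_nonneg h2]
  calc A * (η * (|m (t + 1)| * a (t + 1)))
      ≤ A * (A * θ * (decayedSum γ (fun k => |g k|) (t + 1) * A)) := by
        gcongr
        · exact p.η_le
        · exact p.abs_m_le _
        · exact p.a_le _
    _ = _ := by ring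

lemma abs_sq_h_succ_sub_le (p : IsPath A θ η γ β D₀ D₁ T h b x s r g m a) (t : ℕ) :
    |h (x (t + 1)) ^ 2 - h (x t) ^ 2| ≤ 2 * A ^ 6 * θ * energy γ h x r g t := by
  have hA := p.one_le_A
  have hA0 := p.A_pos
  have h3 := p.θ_nonneg
  have hM := p.decayed_nonneg (t + 1)
  have hd := p.abs_h_succ_sub_le t
  set M := decayedSum γ (fun k => |g k|) (t + 1) with hMdef
  have e : h (x (t + 1)) ^ 2 - h (x t) ^ 2
      = (h (x (t + 1)) - h (x t)) * (2 * h (x t) + (h (x (t + 1)) - h (x t))) := by ring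
  rw [e, abs_mul]
  have h4 : |2 * h (x t) + (h (x (t + 1)) - h (x t))| ≤ 2 * |h (x t)| + A ^ 3 * θ * M := by
    refine (abs_add_le _ _).trans ?_
    rw [abs_mul, abs_two]
    linarith
  have hA3 : A ^ 3 ≤ A ^ 6 := pow_le_pow_right₀ hA (by norm_num)
  have hJ : h (x t) ^ 2 + M ^ 2 ≤ energy γ h x r g t := by
    unfold energy; linarith [sq_nonneg (r t)]
  have hM2 : M ^ 2 ≤ energy γ h x r g t := sq_decayed_le_energy t
  calc |h (x (t + 1)) - h (x t)| * |2 * h (x t) + (h (x (t + 1)) - h (x t))|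
      ≤ (A ^ 3 * θ * M) * (2 * |h (x t)| + A ^ 3 * θ * M) := by gcongr
    _ = A ^ 3 * θ * (2 * |h (x t)| * M) + A ^ 6 * θ * (θ * M ^ 2) := by ring
    _ ≤ A ^ 6 * θ * energy γ h x r g t + A ^ 6 * θ * (1 * energy γ h x r g t) := by
        gcongr
        · nlinarith [sq_nonneg (|h (x t)| - M), sq_abs (h (x t))]
        · exact p.θ_le
    _ = _ := by ring

/-- Up to an error of order `θ * |r t|`, `g t` is a bounded multiple of `s t`; Young's inequality
weighted by `σ = D₀ + D₁ * h (x t) ^ 2` does the rest. The stepsize weight `z` is left free so that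
it can stay fixed while `t` moves back in the next induction. -/
lemma abs_mul_g_mul_le (p : IsPath A θ η γ β D₀ D₁ T h b x s r g m a) {t : ℕ} (ht : t < T)
    {z : ℝ} (hz : 0 ≤ z) (hza : z ≤ a t) :
    |h (x t)| * |g t| * z ≤ 1 / (2 * A ^ 2) * normalized D₀ D₁ h x s a t
      + A ^ 4 / 2 * (D₀ + D₁ * h (x t) ^ 2) * z + A ^ 13 * θ * energy γ h x r g t := by
  have hA := p.one_le_A
  have hA0 := p.A_pos
  have hθ := p.θ_nonneg
  have hb := p.b_le t ht
  have hb1 := p.one_le_b t ht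
  have ha := p.a_nonneg t
  have hD0 := p.D₀_pos
  have hD1 := p.D₁_nonneg
  set σ := D₀ + D₁ * h (x t) ^ 2 with hσ
  have hσ0 : 0 < σ := by positivity
  have hg : |g t| ≤ A * |s t| + A ^ 5 * θ * |r t| := by
    have e : g t = b t * s t + (g t - b t * s t) := by ring
    rw [e]
    refine (abs_add_le _ _).trans (add_le_add ?_ (p.g_sub t ht))
    rw [abs_mul, abs_of_nonneg (by linarith : 0 ≤ b t)]
    gcongr
  have young : |h (x t)| * |s t| * A * z
      ≤ 1 / (2 * A ^ 2) * normalized D₀ D₁ h x s a t + A ^ 4 / 2 * σ * z := by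
    rcases hz.eq_or_lt with h0 | hz
    · rw [← h0]
      simpa using mul_nonneg (by positivity) (p.normalized_nonneg t)
    have e1 : 1 / (2 * A ^ 2) * (h (x t) ^ 2 * s t ^ 2 / σ * z) + A ^ 4 / 2 * σ * z
        - |h (x t)| * |s t| * A * z
        = z / (2 * A ^ 2 * σ) * (|h (x t)| * |s t| - A ^ 3 * σ) ^ 2 := by
      rw [← sq_abs (h (x t)), ← sq_abs (s t)]
      field_simp
      ring
    have e2 : 1 / (2 * A ^ 2) * (h (x t) ^ 2 * s t ^ 2 / σ * z)
        ≤ 1 / (2 * A ^ 2) * normalized D₀ D₁ h x s a t := by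
      unfold normalized
      rw [← hσ]
      gcongr
    have e3 : 0 ≤ z / (2 * A ^ 2 * σ) * (|h (x t)| * |s t| - A ^ 3 * σ) ^ 2 := by positivity
    linarith
  have hr : |h (x t)| * |r t| ≤ energy γ h x r g t := by
    unfold energy
    nlinarith [sq_nonneg (|h (x t)| - |r t|), sq_abs (h (x t)), sq_abs (r t),
      sq_nonneg (decayedSum γ (fun k => |g k|) (t + 1))]
  have hJ := energy_nonneg γ h x r g t
  have hzA : z ≤ A := hza.trans (p.a_le t)
  calc |h (x t)| * |g t| * z ≤ |h (x t)| * (A * |s t| + A ^ 5 * θ * |r t|) * z := by gcongr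
    _ = |h (x t)| * |s t| * A * z + A ^ 5 * θ * (|h (x t)| * |r t|) * z := by ring
    _ ≤ (1 / (2 * A ^ 2) * normalized D₀ D₁ h x s a t + A ^ 4 / 2 * σ * z)
        + A ^ 5 * θ * energy γ h x r g t * A := by gcongr
    _ = (1 / (2 * A ^ 2) * normalized D₀ D₁ h x s a t + A ^ 4 / 2 * σ * z)
        + A ^ 6 * θ * energy γ h x r g t := by ring
    _ ≤ _ := by
        gcongr
        norm_num

/-- Unrolls the momentum one gradient at a time with `z` fixed, which is legitimate because `a` is
nonincreasing. Comparing `h` and `σ` at neighbouring times costs a multiple of `θ * energy`; the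
subtracted `energy` is the slack that lets the induction close. -/
lemma abs_mul_decayed_mul_le (p : IsPath A θ η γ β D₀ D₁ T h b x s r g m a) {t : ℕ} (ht : t < T)
    {z : ℝ} (hz : 0 ≤ z) (hza : z ≤ a t) :
    |h (x t)| * decayedSum γ (fun k => |g k|) (t + 1) * z
      ≤ 1 / (2 * A ^ 2) * decayedSum γ (normalized D₀ D₁ h x s a) (t + 1)
        + A ^ 5 * (D₀ + D₁ * h (x t) ^ 2) * z
        + 3 * A ^ 13 * θ * (2 * decayedSum γ (energy γ h x r g) (t + 1)
          - energy γ h x r g t) := by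
  have hA := p.one_le_A
  have hA0 := p.A_pos
  have hθ := p.θ_nonneg
  have hD0 := p.D₀_pos
  have hD1 := p.D₁_nonneg
  have hγ := p.γ_nonneg
  have hγ1 := p.γ_lt_one
  induction t with
  | zero =>
    have h1 := p.abs_mul_g_mul_le ht hz hza
    have hJ := energy_nonneg γ h x r g 0
    have h2 : A ^ 4 / 2 ≤ A ^ 5 := by
      have : A ^ 4 ≤ A ^ 5 := pow_le_pow_right₀ hA (by norm_num)
      have : 0 ≤ A ^ 4 := by positivity
      linarith
    have h3 : A ^ 4 / 2 * (D₀ + D₁ * h (x 0) ^ 2) * z ≤ A ^ 5 * (D₀ + D₁ * h (x 0) ^ 2) * z := by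
      gcongr
    have h4 : 0 ≤ A ^ 13 * θ * energy γ h x r g 0 := by positivity
    simp only [decayedSum, mul_zero, zero_add] at *
    linarith
  | succ t ih =>
    have ht' : t < T := by omega
    have hza' : z ≤ a t := hza.trans (p.a_anti t)
    have IH := ih ht' hza'
    have h1 := p.abs_mul_g_mul_le ht hz hza
    have h2 := p.abs_h_succ_sub_le t
    have h3 := p.abs_sq_h_succ_sub_le t
    have hM := p.decayed_nonneg (t + 1)
    have hzA : z ≤ A := hza.trans (p.a_le _)
    have hJ := energy_nonneg γ h x r g t
    have hJ' := energy_nonneg γ h x r g (t + 1)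
    have hMJ : decayedSum γ (fun k => |g k|) (t + 1) ^ 2 ≤ energy γ h x r g t :=
      sq_decayed_le_energy t
    have e1 : decayedSum γ (fun k => |g k|) (t + 1 + 1)
      = γ * decayedSum γ (fun k => |g k|) (t + 1) + |g (t + 1)| := rfl
    have e2 : decayedSum γ (normalized D₀ D₁ h x s a) (t + 1 + 1)
      = γ * decayedSum γ (normalized D₀ D₁ h x s a) (t + 1)
        + normalized D₀ D₁ h x s a (t + 1) := rfl
    have e3 : decayedSum γ (energy γ h x r g) (t + 1 + 1)
      = γ * decayedSum γ (energy γ h x r g) (t + 1) + energy γ h x r g (t + 1) := rfl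
    rw [e1, e2, e3]
    generalize decayedSum γ (fun k => |g k|) (t + 1) = M at *
    generalize decayedSum γ (normalized D₀ D₁ h x s a) (t + 1) = W at *
    generalize decayedSum γ (energy γ h x r g) (t + 1) = D at *
    generalize energy γ h x r g t = J at *
    generalize energy γ h x r g (t + 1) = J' at *
    generalize normalized D₀ D₁ h x s a (t + 1) = Y at *
    have k1 : |h (x (t + 1))| ≤ |h (x t)| + A ^ 3 * θ * M := by
      have := abs_add_le (h (x t)) (h (x (t + 1)) - h (x t))
      rw [add_sub_cancel] at this
      linarith
    have k2 : |h (x (t + 1))| * M * z ≤ |h (x t)| * M * z + A ^ 13 * θ * J := by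
      calc |h (x (t + 1))| * M * z ≤ (|h (x t)| + A ^ 3 * θ * M) * M * z := by gcongr
        _ = |h (x t)| * M * z + A ^ 3 * θ * M ^ 2 * z := by ring
        _ ≤ |h (x t)| * M * z + A ^ 3 * θ * J * A := by gcongr
        _ = |h (x t)| * M * z + A ^ 4 * θ * J := by ring
        _ ≤ _ := by gcongr; norm_num
    have k3 : A ^ 5 * (D₀ + D₁ * h (x t) ^ 2) * z
        ≤ A ^ 5 * (D₀ + D₁ * h (x (t + 1)) ^ 2) * z + 2 * A ^ 13 * θ * J := by
      have : h (x t) ^ 2 ≤ h (x (t + 1)) ^ 2 + 2 * A ^ 6 * θ * J := by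
        linarith [(abs_le.1 h3).1]
      calc A ^ 5 * (D₀ + D₁ * h (x t) ^ 2) * z
          ≤ A ^ 5 * (D₀ + D₁ * (h (x (t + 1)) ^ 2 + 2 * A ^ 6 * θ * J)) * z := by gcongr
        _ = A ^ 5 * (D₀ + D₁ * h (x (t + 1)) ^ 2) * z + A ^ 5 * D₁ * (2 * A ^ 6 * θ * J) * z := by
            ring
        _ ≤ A ^ 5 * (D₀ + D₁ * h (x (t + 1)) ^ 2) * z
            + A ^ 5 * A * (2 * A ^ 6 * θ * J) * A := by
            gcongr
            exact p.D₁_le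
        _ = _ := by ring
    set S := (D₀ + D₁ * h (x (t + 1)) ^ 2) * z with hS
    have hS0 : 0 ≤ S := by positivity
    -- The decay frees a share `(1 - γ) * A ^ 5 ≥ A ^ 4` of the coefficient, enough for the
    -- contribution of the newest gradient.
    have k4 : γ * (A ^ 5 * S) + A ^ 4 / 2 * S ≤ A ^ 5 * S := by
      have : A ^ 4 / 2 ≤ A ^ 5 * (1 - γ) := by
        have := mul_le_mul_of_nonneg_left p.gap (by positivity : 0 ≤ A ^ 4)
        have h4 : 0 ≤ A ^ 4 := by positivity
        nlinarith
      nlinarith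
    -- Moving `h` costs one unit `A ^ 13 * θ * J` and moving `σ` two; these three units are
    -- cancelled by the `- J` of the induction hypothesis.
    have k5 : γ * (|h (x (t + 1))| * M * z) ≤ γ * (1 / (2 * A ^ 2) * W + A ^ 5 * S
        + 3 * A ^ 13 * θ * (2 * D - J) + 3 * A ^ 13 * θ * J) := by
      apply mul_le_mul_of_nonneg_left _ hγ
      rw [hS]
      linarith
    have k6 : 0 ≤ A ^ 13 * θ * J' := by positivity
    rw [mul_assoc (A ^ 4 / 2), ← hS] at h1
    rw [mul_assoc (A ^ 5), ← hS]
    linarith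

end IsPath

/-! ### The accumulated descent inequality along a path -/

namespace IsPath

variable {A θ η γ β D₀ D₁ : ℝ} {T : ℕ} {h : ℝ → ℝ} {b x s r g m a : ℕ → ℝ}

/-- Bounds the distance from `x t` to the shifted point. The factor `γ` stays with the decayed sum
because `γ * M_t ≤ M_{t+1}`, which belongs to the energy of step `t`. -/
lemma momentum_shift_le (p : IsPath A θ η γ β D₀ D₁ T h b x s r g m a) (t : ℕ) :
    |η * (γ / (1 - γ)) * (m t * a t)| ≤ A ^ 3 * θ * (γ * decayedSum γ (fun k => |g k|) t) := by
  have hA0 := p.A_pos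
  have hθ := p.θ_nonneg
  have hγ := p.γ_nonneg
  have hγ1 : 0 < 1 - γ := by linarith [p.γ_lt_one]
  have hM := p.decayed_nonneg t
  have e : η * (γ / (1 - γ)) * (m t * a t) = η * (1 / (1 - γ)) * (γ * m t) * a t := by ring
  rw [e, abs_mul, abs_mul, abs_mul, abs_mul γ, abs_of_nonneg p.η_nonneg,
    abs_of_nonneg (by positivity : 0 ≤ 1 / (1 - γ)), abs_of_nonneg hγ, abs_of_nonneg (p.a_nonneg t)]
  calc η * (1 / (1 - γ)) * (γ * |m t|) * a t
      ≤ A * θ * A * (γ * decayedSum γ (fun k => |g k|) t) * A := by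
        gcongr
        · exact p.a_nonneg t
        · exact p.η_le
        · exact p.inv_gap_le
        · exact p.abs_m_le t
        · exact p.a_le t
    _ = _ := by ring

/-- At the shifted point the old momentum drops out of the increment, except where it multiplies the
change of stepsize. The main term uses `a t`, not `a (t + 1)`, so that the fresh sample can later be
integrated out. -/
lemma descent_step (p : IsPath A θ η γ β D₀ D₁ T h b x s r g m a) {φ : ℝ → ℝ}
    (hφ : ∀ x, HasDerivAt φ (h x) x) {t : ℕ} (ht : t < T) :
    φ (x (t + 1) - η * (γ / (1 - γ)) * (m (t + 1) * a (t + 1)))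
      ≤ φ (x t - η * (γ / (1 - γ)) * (m t * a t))
        - η * ((1 - β) / (1 - γ)) * (b t * (h (x t) * s t * a t))
        + η * A * (|h (x t)| * decayedSum γ (fun k => |g k|) (t + 1) * (a t - a (t + 1)))
        + 3 * A ^ 8 * θ ^ 2 * energy γ h x r g t := by
  have hA := p.one_le_A
  have hA0 := p.A_pos
  have hθ := p.θ_nonneg
  have hη := p.η_nonneg
  have hγ := p.γ_nonneg
  have hγ1 : 0 < 1 - γ := by linarith [p.γ_lt_one]
  have hβ : 0 ≤ 1 - β := by linarith [p.β_le]
  have hβ1 : 1 - β ≤ 1 := by linarith [p.β_nonneg]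
  have ha := p.a_nonneg t
  have ha' := p.a_nonneg (t + 1)
  have hδ : 0 ≤ a t - a (t + 1) := by linarith [p.a_anti t]
  have hM := p.decayed_nonneg t
  have hM1 := p.decayed_nonneg (t + 1)
  have hMJ : decayedSum γ (fun k => |g k|) (t + 1) ^ 2 ≤ energy γ h x r g t :=
    sq_decayed_le_energy t
  have hr : |h (x t)| * |r t| ≤ energy γ h x r g t := by
    unfold energy
    nlinarith [sq_nonneg (|h (x t)| - |r t|), sq_abs (h (x t)), sq_abs (r t),
      sq_nonneg (decayedSum γ (fun k => |g k|) (t + 1))]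
  have hshift := p.momentum_shift_le t
  have hm := p.abs_m_le t
  have hgs := p.g_sub t ht
  have eM : decayedSum γ (fun k => |g k|) (t + 1)
    = γ * decayedSum γ (fun k => |g k|) t + |g t| := rfl
  have hJ := energy_nonneg γ h x r g t
  set y := x t - η * (γ / (1 - γ)) * (m t * a t) with hy
  set y' := x (t + 1) - η * (γ / (1 - γ)) * (m (t + 1) * a (t + 1)) with hy'
  generalize decayedSum γ (fun k => |g k|) t = M at *
  generalize decayedSum γ (fun k => |g k|) (t + 1) = M' at *
  generalize energy γ h x r g t = J at *
  -- From `1 + γ / (1 - γ) = 1 / (1 - γ)`: the coefficients of `m t * a (t + 1)` and `m t * a t`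
  -- become opposite.
  have hdiff : y' - y = - (η * ((1 - β) / (1 - γ)) * (g t * a (t + 1)))
      + η * (γ / (1 - γ)) * (m t * (a t - a (t + 1))) := by
    rw [hy', hy, p.x_succ, p.m_succ]
    field_simp
    ring
  have hκ : (1 - β) / (1 - γ) ≤ 1 / (1 - γ) := by gcongr
  have hγM : γ * M ≤ M' := by rw [eM]; linarith [abs_nonneg (g t)]
  have habs : |y' - y| ≤ A ^ 3 * θ * M' := by
    rw [hdiff]
    refine (abs_add_le _ _).trans ?_
    rw [abs_neg, abs_mul, abs_mul, abs_mul, abs_mul, abs_mul η, abs_mul (m t), abs_of_nonneg hη,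
      abs_of_nonneg (div_nonneg hβ hγ1.le), abs_of_nonneg (div_nonneg hγ hγ1.le),
      abs_of_nonneg ha', abs_of_nonneg hδ]
    calc η * ((1 - β) / (1 - γ)) * (|g t| * a (t + 1))
          + η * (γ / (1 - γ)) * (|m t| * (a t - a (t + 1)))
        ≤ η * (1 / (1 - γ)) * (|g t| * A) + η * (γ / (1 - γ)) * (M * A) := by
          gcongr
          · exact p.a_le _
          · linarith [p.a_le t]
      _ = η * (1 / (1 - γ)) * (M' * A) := by rw [eM]; ring
      _ ≤ A * θ * A * (M' * A) := by
          gcongr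
          · exact p.η_le
          · exact p.inv_gap_le
      _ = _ := by ring
  have hhy : |h y - h (x t)| ≤ A * (A ^ 3 * θ * M') := by
    refine (p.lip _ _).trans ?_
    have : |y - x t| ≤ A ^ 3 * θ * M' := by
      have e : y - x t = -(η * (γ / (1 - γ)) * (m t * a t)) := by rw [hy]; ring
      rw [e, abs_neg]
      refine hshift.trans ?_
      gcongr
    gcongr
  have main := (abs_le.1 (abs_sub_linear_le hφ p.lip hA0.le y y')).2
  have q1 : A * (y' - y) ^ 2 ≤ A ^ 8 * θ ^ 2 * J := by
    rw [← sq_abs]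
    calc A * |y' - y| ^ 2 ≤ A * (A ^ 3 * θ * M') ^ 2 := by gcongr
      _ = A ^ 7 * θ ^ 2 * M' ^ 2 := by ring
      _ ≤ A ^ 8 * θ ^ 2 * J := by
        gcongr
        norm_num
  have q2 : (h y - h (x t)) * (y' - y) ≤ A ^ 8 * θ ^ 2 * J := by
    refine (le_abs_self _).trans ?_
    rw [abs_mul]
    calc |h y - h (x t)| * |y' - y| ≤ A * (A ^ 3 * θ * M') * (A ^ 3 * θ * M') := by gcongr
      _ = A ^ 7 * θ ^ 2 * M' ^ 2 := by ring
      _ ≤ A ^ 8 * θ ^ 2 * J := by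
        gcongr
        norm_num
  have q3 : - (η * ((1 - β) / (1 - γ)) * (h (x t) * (g t - b t * s t) * a t))
      ≤ A ^ 8 * θ ^ 2 * J := by
    refine (neg_le_abs _).trans ?_
    rw [abs_mul, abs_mul, abs_mul, abs_mul (h (x t)), abs_of_nonneg hη,
      abs_of_nonneg (div_nonneg hβ hγ1.le), abs_of_nonneg ha]
    calc η * ((1 - β) / (1 - γ)) * (|h (x t)| * |g t - b t * s t| * a t)
        ≤ A * θ * A * (|h (x t)| * (A ^ 5 * θ * |r t|) * A) := by
          have := div_nonneg hβ hγ1.le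
          gcongr
          · exact p.η_le
          · exact hκ.trans p.inv_gap_le
          · exact p.a_le t
      _ = A ^ 8 * θ ^ 2 * (|h (x t)| * |r t|) := by ring
      _ ≤ _ := by gcongr
  -- Replacing `a (t + 1)` by `a t` in the gradient term adds `|g t|` to the `γ * |m t|` already
  -- present; together they are dominated by the next decayed sum `M'`.
  have q4 : η * ((1 - β) / (1 - γ)) * (h (x t) * g t * (a t - a (t + 1)))
      + η * (γ / (1 - γ)) * (h (x t) * m t * (a t - a (t + 1)))
      ≤ η * A * (|h (x t)| * M' * (a t - a (t + 1))) := by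
    have l1 : h (x t) * g t ≤ |h (x t)| * |g t| := (le_abs_self _).trans (abs_mul _ _).le
    have l2 : h (x t) * m t ≤ |h (x t)| * M :=
      (le_abs_self _).trans ((abs_mul _ _).le.trans (by gcongr))
    calc η * ((1 - β) / (1 - γ)) * (h (x t) * g t * (a t - a (t + 1)))
          + η * (γ / (1 - γ)) * (h (x t) * m t * (a t - a (t + 1)))
        ≤ η * ((1 - β) / (1 - γ)) * (|h (x t)| * |g t| * (a t - a (t + 1)))
          + η * (γ / (1 - γ)) * (|h (x t)| * M * (a t - a (t + 1))) := by
          have := div_nonneg hβ hγ1.le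
          have := div_nonneg hγ hγ1.le
          gcongr
      _ ≤ η * (1 / (1 - γ)) * (|h (x t)| * |g t| * (a t - a (t + 1)))
          + η * (γ / (1 - γ)) * (|h (x t)| * M * (a t - a (t + 1))) := by
          gcongr
      _ = η * (1 / (1 - γ)) * (|h (x t)| * M' * (a t - a (t + 1))) := by rw [eM]; ring
      _ ≤ _ := by
          have : 0 ≤ M' := hM1
          gcongr
          exact p.inv_gap_le
  have e : h y * (y' - y) = (h y - h (x t)) * (y' - y)
      - η * ((1 - β) / (1 - γ)) * (b t * (h (x t) * s t * a t))
      + -(η * ((1 - β) / (1 - γ)) * (h (x t) * (g t - b t * s t) * a t))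
      + (η * ((1 - β) / (1 - γ)) * (h (x t) * g t * (a t - a (t + 1)))
      + η * (γ / (1 - γ)) * (h (x t) * m t * (a t - a (t + 1)))) := by
    have : h y * (y' - y) = (h y - h (x t)) * (y' - y) + h (x t) * (y' - y) := by ring
    rw [this, hdiff]
    ring
  linarith

/-- Summation by parts: the boundary terms involve `h ^ 2 * a`, and the increments of `h ^ 2` are of
order `θ * energy`. -/
lemma sum_sq_h_mul_le (p : IsPath A θ η γ β D₀ D₁ T h b x s r g m a) (N : ℕ) :
    ∑ t ∈ Finset.range N, h (x t) ^ 2 * (a t - a (t + 1)) + h (x N) ^ 2 * a N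
      ≤ h (x 0) ^ 2 * a 0 + 2 * A ^ 7 * θ * ∑ t ∈ Finset.range N, energy γ h x r g t := by
  have hA0 := p.A_pos
  have hθ := p.θ_nonneg
  induction N with
  | zero => simp
  | succ N ih =>
    rw [Finset.sum_range_succ, Finset.sum_range_succ]
    have h1 := (abs_le.1 (p.abs_sq_h_succ_sub_le N)).2
    have hJ := energy_nonneg γ h x r g N
    have h2 : (h (x (N + 1)) ^ 2 - h (x N) ^ 2) * a (N + 1)
        ≤ 2 * A ^ 7 * θ * energy γ h x r g N := by
      calc (h (x (N + 1)) ^ 2 - h (x N) ^ 2) * a (N + 1)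
          ≤ 2 * A ^ 6 * θ * energy γ h x r g N * A :=
            mul_le_mul h1 (p.a_le _) (p.a_nonneg _) (by positivity)
        _ = _ := by ring
    linarith

lemma sum_second_moment_mul_le (p : IsPath A θ η γ β D₀ D₁ T h b x s r g m a) (N : ℕ) :
    ∑ t ∈ Finset.range N, (D₀ + D₁ * h (x t) ^ 2) * (a t - a (t + 1))
      ≤ A ^ 2 * (1 + h (x 0) ^ 2)
        + 2 * A ^ 8 * θ * ∑ t ∈ Finset.range N, energy γ h x r g t := by
  have hA0 := p.A_pos
  have hθ := p.θ_nonneg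
  have h1 := p.sum_sq_h_mul_le N
  have h0 : 0 ≤ h (x N) ^ 2 * a N := mul_nonneg (sq_nonneg _) (p.a_nonneg N)
  have hJ : 0 ≤ ∑ t ∈ Finset.range N, energy γ h x r g t :=
    Finset.sum_nonneg fun t _ => energy_nonneg γ h x r g t
  have e : ∑ t ∈ Finset.range N, (D₀ + D₁ * h (x t) ^ 2) * (a t - a (t + 1))
      = D₀ * (a 0 - a N) + D₁ * ∑ t ∈ Finset.range N, h (x t) ^ 2 * (a t - a (t + 1)) := by
    rw [← Finset.sum_range_sub' a N, Finset.mul_sum, Finset.mul_sum, ← Finset.sum_add_distrib]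
    exact Finset.sum_congr rfl fun t _ => by ring
  rw [e]
  have k1 : D₀ * (a 0 - a N) ≤ A * A :=
    mul_le_mul_of_nonneg p.D₀_le (by linarith [p.a_le 0, p.a_nonneg N]) p.D₀_pos.le hA0.le
  have k2 : D₁ * ∑ t ∈ Finset.range N, h (x t) ^ 2 * (a t - a (t + 1))
      ≤ A * (h (x 0) ^ 2 * A + 2 * A ^ 7 * θ * ∑ t ∈ Finset.range N, energy γ h x r g t) := by
    have l1 : ∑ t ∈ Finset.range N, h (x t) ^ 2 * (a t - a (t + 1))
        ≤ h (x 0) ^ 2 * A + 2 * A ^ 7 * θ * ∑ t ∈ Finset.range N, energy γ h x r g t := by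
      have := mul_le_mul_of_nonneg_left (p.a_le 0) (sq_nonneg (h (x 0)))
      linarith
    exact mul_le_mul_of_nonneg p.D₁_le l1 p.D₁_nonneg (by positivity)
  linarith

/-- The accumulated descent inequality along a path. -/
lemma accumulated_descent (p : IsPath A θ η γ β D₀ D₁ T h b x s r g m a) {φ : ℝ → ℝ}
    (hφ : ∀ x, HasDerivAt φ (h x) x) {N : ℕ} (hN : N ≤ T) :
    φ (x N - η * (γ / (1 - γ)) * (m N * a N))
        + η * ((1 - β) / (1 - γ)) * ∑ t ∈ Finset.range N, b t * (h (x t) * s t * a t)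
      ≤ φ (x 0) + η / 2 * ∑ t ∈ Finset.range N, normalized D₀ D₁ h x s a t
        + A ^ 9 * (1 + h (x 0) ^ 2)
        + 11 * A ^ 16 * θ ^ 2 * ∑ t ∈ Finset.range N, energy γ h x r g t := by
  have hA := p.one_le_A
  have hA0 := p.A_pos
  have hθ := p.θ_nonneg
  have hη := p.η_nonneg
  have hγ := p.γ_nonneg
  have step : ∀ n ≤ T, φ (x n - η * (γ / (1 - γ)) * (m n * a n))
        + η * ((1 - β) / (1 - γ)) * ∑ t ∈ Finset.range n, b t * (h (x t) * s t * a t)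
      ≤ φ (x 0) + η * A * ∑ t ∈ Finset.range n,
          |h (x t)| * decayedSum γ (fun k => |g k|) (t + 1) * (a t - a (t + 1))
        + 3 * A ^ 8 * θ ^ 2 * ∑ t ∈ Finset.range n, energy γ h x r g t := by
    intro n
    induction n with
    | zero => simp [p.m_zero]
    | succ n ih =>
      intro hn
      have := p.descent_step hφ (by omega : n < T)
      have := ih (by omega)
      simp only [Finset.sum_range_succ, mul_add]
      linarith
  have hJ : 0 ≤ ∑ t ∈ Finset.range N, energy γ h x r g t :=
    Finset.sum_nonneg fun t _ => energy_nonneg γ h x r g t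
  have hW : 0 ≤ ∑ t ∈ Finset.range N, normalized D₀ D₁ h x s a t :=
    Finset.sum_nonneg fun t _ => p.normalized_nonneg t
  have hS := p.sum_second_moment_mul_le N
  have cross : ∑ t ∈ Finset.range N,
        |h (x t)| * decayedSum γ (fun k => |g k|) (t + 1) * (a t - a (t + 1))
      ≤ 1 / (2 * A ^ 2) * (A * ∑ t ∈ Finset.range N, normalized D₀ D₁ h x s a t)
        + A ^ 5 * (A ^ 2 * (1 + h (x 0) ^ 2)
          + 2 * A ^ 8 * θ * ∑ t ∈ Finset.range N, energy γ h x r g t)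
        + 6 * A ^ 13 * θ * (A * ∑ t ∈ Finset.range N, energy γ h x r g t) := by
    calc ∑ t ∈ Finset.range N,
          |h (x t)| * decayedSum γ (fun k => |g k|) (t + 1) * (a t - a (t + 1))
        ≤ ∑ t ∈ Finset.range N, (1 / (2 * A ^ 2) * decayedSum γ (normalized D₀ D₁ h x s a) (t + 1)
          + A ^ 5 * ((D₀ + D₁ * h (x t) ^ 2) * (a t - a (t + 1)))
          + 6 * A ^ 13 * θ * decayedSum γ (energy γ h x r g) (t + 1)) := by
          refine Finset.sum_le_sum fun t ht => ?_
          have := p.abs_mul_decayed_mul_le (t := t) (z := a t - a (t + 1))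
            (by have := Finset.mem_range.1 ht; omega) (by linarith [p.a_anti t])
            (by linarith [p.a_nonneg (t + 1)])
          have k : 0 ≤ 3 * A ^ 13 * θ * energy γ h x r g t :=
            mul_nonneg (by positivity) (energy_nonneg γ h x r g t)
          linarith
      _ = 1 / (2 * A ^ 2) * ∑ t ∈ Finset.range N, decayedSum γ (normalized D₀ D₁ h x s a) (t + 1)
          + A ^ 5 * ∑ t ∈ Finset.range N, (D₀ + D₁ * h (x t) ^ 2) * (a t - a (t + 1))
          + 6 * A ^ 13 * θ * ∑ t ∈ Finset.range N, decayedSum γ (energy γ h x r g) (t + 1) := by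
          simp only [Finset.sum_add_distrib, Finset.mul_sum]
      _ ≤ _ := by
          gcongr
          · exact sum_decayedSum_le hγ hA0.le p.gap p.normalized_nonneg N
          · exact sum_decayedSum_le hγ hA0.le p.gap (energy_nonneg γ h x r g) N
  have hst := step N hN
  generalize ∑ t ∈ Finset.range N, energy γ h x r g t = J at *
  generalize ∑ t ∈ Finset.range N, normalized D₀ D₁ h x s a t = W at *
  have final : η * A * ∑ t ∈ Finset.range N,
        |h (x t)| * decayedSum γ (fun k => |g k|) (t + 1) * (a t - a (t + 1))
      ≤ η / 2 * W + A ^ 9 * (1 + h (x 0) ^ 2) + 8 * A ^ 16 * θ ^ 2 * J := by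
    calc _ ≤ η * A * (1 / (2 * A ^ 2) * (A * W)
        + A ^ 5 * (A ^ 2 * (1 + h (x 0) ^ 2) + 2 * A ^ 8 * θ * J)
        + 6 * A ^ 13 * θ * (A * J)) := by gcongr
      -- The weight `1 / (2 * A ^ 2)` in Young's inequality was chosen for this: `A` from the
      -- decayed sum and `A` from `descent_step` leave `η / 2`.
      _ = η / 2 * W + η * (A ^ 8 * (1 + h (x 0) ^ 2)) + η * ((2 * A ^ 14 + 6 * A ^ 15) * θ * J) := by
        field_simp
        ring
      _ ≤ η / 2 * W + (A * 1) * (A ^ 8 * (1 + h (x 0) ^ 2))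
          + (A * θ) * ((2 * A ^ 15 + 6 * A ^ 15) * θ * J) := by
        gcongr
        · exact p.η_le.trans (by gcongr; exact p.θ_le)
        · exact p.η_le
        · norm_num
      _ = _ := by ring
  have k : 3 * A ^ 8 * θ ^ 2 * J ≤ 3 * A ^ 16 * θ ^ 2 * J := by
    gcongr
    norm_num
  linarith

/-- The accumulated descent inequality in terms of gradients only. -/
lemma accumulated_gradient_bound (p : IsPath A θ η γ β D₀ D₁ T h b x s r g m a) {φ : ℝ → ℝ}
    (hφ : ∀ x, HasDerivAt φ (h x) x) (hb : ∀ y, φ (x 0) - φ y ≤ A) {N : ℕ} (hN : N ≤ T) :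
    h (x N) ^ 2 / (8 * A)
        + η * ((1 - β) / (1 - γ)) * ∑ t ∈ Finset.range N, b t * (h (x t) * s t * a t)
      ≤ η / 2 * ∑ t ∈ Finset.range N, normalized D₀ D₁ h x s a t + 6 * A ^ 11
        + 12 * A ^ 16 * θ ^ 2 * ∑ t ∈ Finset.range N, energy γ h x r g t := by
  have hA := p.one_le_A
  have hA0 := p.A_pos
  have hθ := p.θ_nonneg
  have h1 := p.accumulated_descent hφ hN
  have h2 := p.momentum_shift_le N
  have h0 : h (x 0) ^ 2 ≤ 4 * A ^ 2 := by
    have := sq_deriv_le hφ p.lip hA0 hb (x 0)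
    nlinarith
  have hJ : 0 ≤ ∑ t ∈ Finset.range N, energy γ h x r g t :=
    Finset.sum_nonneg fun t _ => energy_nonneg γ h x r g t
  -- For `N = 0` the momentum vanishes; otherwise its decayed sum is part of the energy of step `N -
  -- 1`.
  have hM : (γ * decayedSum γ (fun k => |g k|) N) ^ 2
      ≤ ∑ t ∈ Finset.range N, energy γ h x r g t := by
    rcases N with _ | n
    · simp [decayedSum]
    · have hM := p.decayed_nonneg (n + 1)
      calc (γ * decayedSum γ (fun k => |g k|) (n + 1)) ^ 2
          ≤ (decayedSum γ (fun k => |g k|) (n + 1)) ^ 2 :=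
            pow_le_pow_left₀ (mul_nonneg p.γ_nonneg hM)
              (mul_le_of_le_one_left hM p.γ_lt_one.le) 2
        _ ≤ energy γ h x r g n := sq_decayed_le_energy n
        _ ≤ _ := Finset.single_le_sum (f := energy γ h x r g)
              (fun t _ => energy_nonneg γ h x r g t) (Finset.self_mem_range_succ n)
  set z := η * (γ / (1 - γ)) * (m N * a N) with hz
  have h3 := sq_deriv_le hφ p.lip hA0 hb (x N - z)
  have h4 := p.lip (x N) (x N - z)
  rw [sub_sub_cancel] at h4
  generalize ∑ t ∈ Finset.range N, energy γ h x r g t = J at *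
  have h5 : (h (x N) - h (x N - z)) ^ 2 ≤ A ^ 8 * θ ^ 2 * J := by
    rw [← sq_abs]
    calc |h (x N) - h (x N - z)| ^ 2
        ≤ (A * (A ^ 3 * θ * (γ * decayedSum γ (fun k => |g k|) N))) ^ 2 := by
          gcongr
          exact h4.trans (by gcongr)
      _ = A ^ 8 * θ ^ 2 * (γ * decayedSum γ (fun k => |g k|) N) ^ 2 := by ring
      _ ≤ _ := by gcongr
  -- The function gap controls `h` at the shifted point; the Lipschitz bound carries this back to `x
  -- N`, with a factor 2 for the square of a sum.
  have h6 : h (x N) ^ 2 ≤ 8 * A * (φ (x N - z) - φ (x 0) + A) + 2 * (A ^ 8 * θ ^ 2 * J) := by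
    nlinarith [sq_nonneg (h (x N) - 2 * h (x N - z))]
  have h7 : h (x N) ^ 2 / (8 * A) ≤ φ (x N - z) - φ (x 0) + A + A ^ 16 * θ ^ 2 * J := by
    rw [div_le_iff₀ (by positivity)]
    have : A ^ 8 * θ ^ 2 * J ≤ A ^ 17 * θ ^ 2 * J := by gcongr; norm_num
    have : 0 ≤ A ^ 17 * θ ^ 2 * J := by positivity
    linarith
  have h8 : A ^ 9 * (1 + h (x 0) ^ 2) + A ≤ 6 * A ^ 11 := by
    have l1 : A ^ 9 ≤ A ^ 11 := pow_le_pow_right₀ hA (by norm_num)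
    have l2 : A ≤ A ^ 11 := le_self_pow₀ hA (by norm_num)
    have l3 : A ^ 9 * h (x 0) ^ 2 ≤ A ^ 9 * (4 * A ^ 2) := by gcongr
    linarith
  linarith

end IsPath

/-! ### Scalar stochastic gradients and integration over a fresh sample -/

/-- A scalar stochastic gradient `G` with mean `h`: Lipschitz in the weight, with affine
second moment. -/
structure IsSampleGradient {Ξ : Type*} [MeasurableSpace Ξ] (P : Measure Ξ) (G : ℝ → Ξ → ℝ)
    (h : ℝ → ℝ) (L D₀ D₁ : ℝ) : Prop where
  measurable : ∀ x, Measurable (G x)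
  lip : ∀ ξ x y, |G x ξ - G y ξ| ≤ L * |x - y|
  mean : ∀ x, ∫ ξ, G x ξ ∂P = h x
  integrable_sq : ∀ x, Integrable (fun ξ => G x ξ ^ 2) P
  integral_sq_le : ∀ x, ∫ ξ, G x ξ ^ 2 ∂P ≤ D₀ + D₁ * h x ^ 2

lemma continuous_of_abs_sub_le {f : ℝ → ℝ} {L : ℝ} (hf : ∀ x y, |f x - f y| ≤ L * |x - y|) :
    Continuous f := by
  refine (LipschitzWith.of_dist_le_mul (K := L.toNNReal) fun x y => ?_).continuous
  rw [Real.dist_eq, Real.dist_eq]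
  exact (hf x y).trans (mul_le_mul_of_nonneg_right (Real.le_coe_toNNReal L) (abs_nonneg _))

namespace IsSampleGradient

variable {Ξ : Type*} [MeasurableSpace Ξ] {P : Measure Ξ} {G : ℝ → Ξ → ℝ}
  {h : ℝ → ℝ} {L D₀ D₁ : ℝ}

lemma measurable_uncurry (hG : IsSampleGradient P G h L D₀ D₁) :
    Measurable (Function.uncurry G) :=
  measurable_uncurry_of_continuous_of_measurable
    (fun ξ => continuous_of_abs_sub_le (hG.lip ξ)) hG.measurable

variable [IsProbabilityMeasure P]

lemma integrable (hG : IsSampleGradient P G h L D₀ D₁) (x : ℝ) : Integrable (G x) P :=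
  ((memLp_two_iff_integrable_sq (hG.measurable x).aestronglyMeasurable).2
    (hG.integrable_sq x)).integrable (by norm_num)

lemma mean_lip (hG : IsSampleGradient P G h L D₀ D₁) (x y : ℝ) :
    |h x - h y| ≤ L * |x - y| := by
  rw [← hG.mean x, ← hG.mean y, ← integral_sub (hG.integrable x) (hG.integrable y)]
  refine (abs_integral_le_integral_abs).trans ?_
  calc ∫ ξ, |G x ξ - G y ξ| ∂P ≤ ∫ _, L * |x - y| ∂P :=
        integral_mono (((hG.integrable x).sub (hG.integrable y)).abs) (integrable_const _)
          fun ξ => hG.lip ξ x y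
    _ = L * |x - y| := by simp

lemma continuous_mean (hG : IsSampleGradient P G h L D₀ D₁) : Continuous h :=
  continuous_of_abs_sub_le hG.mean_lip

variable {Ω : Type*} [MeasurableSpace Ω] {μ : Measure Ω} [IsProbabilityMeasure μ]
  {X a : Ω → ℝ} {ξ : Ω → Ξ}

/-- Independence in the form of a product law, so that Fubini plays the role of conditional
expectation given the past. -/
lemma map_prod_eq (hX : Measurable X) (ha : Measurable a) (hξ : Measurable ξ)
    (hP : μ.map ξ = P) (hind : IndepFun (fun ω => (X ω, a ω)) ξ μ) :
    μ.map (fun ω => ((X ω, a ω), ξ ω)) = (μ.map fun ω => (X ω, a ω)).prod P := by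
  rw [← hP]
  exact (indepFun_iff_map_prod_eq_prod_map_map (hX.prodMk ha).aemeasurable hξ.aemeasurable).1 hind

/-- Integrating out a fresh sample. -/
lemma integral_fresh (hX : Measurable X) (ha : Measurable a) (hξ : Measurable ξ)
    (hP : μ.map ξ = P) (hind : IndepFun (fun ω => (X ω, a ω)) ξ μ) {ψ : (ℝ × ℝ) × Ξ → ℝ}
    (hψ : Measurable ψ) (hint : Integrable (fun ω => ψ ((X ω, a ω), ξ ω)) μ) :
    Integrable (fun ω => ∫ z, ψ ((X ω, a ω), z) ∂P) μ ∧
      ∫ ω, ψ ((X ω, a ω), ξ ω) ∂μ = ∫ ω, ∫ z, ψ ((X ω, a ω), z) ∂P ∂μ := by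
  have hXa : Measurable fun ω => (X ω, a ω) := hX.prodMk ha
  have hm := map_prod_eq hX ha hξ hP hind
  have hmeas : Measurable fun ω => ((X ω, a ω), ξ ω) := hXa.prodMk hξ
  have hprob : IsProbabilityMeasure (μ.map fun ω => (X ω, a ω)) :=
    Measure.isProbabilityMeasure_map hXa.aemeasurable
  have hint' : Integrable ψ ((μ.map fun ω => (X ω, a ω)).prod P) := by
    rw [← hm, integrable_map_measure hψ.aestronglyMeasurable hmeas.aemeasurable]
    exact hint
  have hin := hint'.integral_prod_left
  refine ⟨hin.comp_measurable hXa, ?_⟩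
  calc ∫ ω, ψ ((X ω, a ω), ξ ω) ∂μ = ∫ p, ψ p ∂(μ.map fun ω => ((X ω, a ω), ξ ω)) :=
        (integral_map hmeas.aemeasurable hψ.aestronglyMeasurable).symm
    _ = ∫ p, ∫ z, ψ (p, z) ∂P ∂(μ.map fun ω => (X ω, a ω)) := by
        rw [hm, integral_prod _ hint']
    _ = _ := integral_map hXa.aemeasurable hin.aestronglyMeasurable

/-- A fresh stochastic gradient is square-integrable. -/
lemma integrable_sq_fresh (hG : IsSampleGradient P G h L D₀ D₁) (hX : Measurable X)
    (ha : Measurable a) (hξ : Measurable ξ)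
    (hP : μ.map ξ = P) (hind : IndepFun (fun ω => (X ω, a ω)) ξ μ)
    (hh : Integrable (fun ω => h (X ω) ^ 2) μ) :
    Integrable (fun ω => G (X ω) (ξ ω) ^ 2) μ := by
  have hXa : Measurable fun ω => (X ω, a ω) := hX.prodMk ha
  have hm := map_prod_eq hX ha hξ hP hind
  have hmeas : Measurable fun ω => ((X ω, a ω), ξ ω) := hXa.prodMk hξ
  have hprob : IsProbabilityMeasure (μ.map fun ω => (X ω, a ω)) :=
    Measure.isProbabilityMeasure_map hXa.aemeasurable
  have hψ : Measurable fun p : (ℝ × ℝ) × Ξ => G p.1.1 p.2 ^ 2 :=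
    (hG.measurable_uncurry.comp (measurable_fst.fst.prodMk measurable_snd)).pow_const 2
  suffices hs : Integrable (fun p : (ℝ × ℝ) × Ξ => G p.1.1 p.2 ^ 2)
      ((μ.map fun ω => (X ω, a ω)).prod P) by
    rw [← hm] at hs
    exact hs.comp_measurable hmeas
  rw [integrable_prod_iff hψ.aestronglyMeasurable]
  refine ⟨.of_forall fun p => hG.integrable_sq p.1, ?_⟩
  have hb : Integrable (fun p : ℝ × ℝ => D₀ + D₁ * h p.1 ^ 2) (μ.map fun ω => (X ω, a ω)) := by
    have hc : Measurable fun p : ℝ × ℝ => D₀ + D₁ * h p.1 ^ 2 :=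
      ((hG.continuous_mean.measurable.comp measurable_fst).pow_const 2).const_mul D₁ |>.const_add D₀
    rw [integrable_map_measure hc.aestronglyMeasurable hXa.aemeasurable]
    exact (integrable_const D₀).add (hh.const_mul D₁)
  refine hb.mono' (hψ.norm.stronglyMeasurable.integral_prod_right').aestronglyMeasurable ?_
  refine .of_forall fun p => ?_
  simp only [Real.norm_eq_abs, abs_pow, sq_abs]
  rw [abs_of_nonneg (integral_nonneg fun _ => sq_nonneg _)]
  exact hG.integral_sq_le p.1

/-- The weighted second moment of a fresh stochastic gradient. -/
lemma integral_mul_sq_fresh_le (hG : IsSampleGradient P G h L D₀ D₁) (hX : Measurable X)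
    (ha : Measurable a) (hξ : Measurable ξ)
    (hP : μ.map ξ = P) (hind : IndepFun (fun ω => (X ω, a ω)) ξ μ)
    {c : ℝ × ℝ → ℝ} (hc : Measurable c) (hc0 : ∀ ω, 0 ≤ c (X ω, a ω))
    (hint : Integrable (fun ω => c (X ω, a ω) * G (X ω) (ξ ω) ^ 2) μ)
    (hint' : Integrable (fun ω => c (X ω, a ω) * (D₀ + D₁ * h (X ω) ^ 2)) μ) :
    ∫ ω, c (X ω, a ω) * G (X ω) (ξ ω) ^ 2 ∂μ
      ≤ ∫ ω, c (X ω, a ω) * (D₀ + D₁ * h (X ω) ^ 2) ∂μ := by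
  have hψ : Measurable fun p : (ℝ × ℝ) × Ξ => c p.1 * G p.1.1 p.2 ^ 2 :=
    (hc.comp measurable_fst).mul
      ((hG.measurable_uncurry.comp (measurable_fst.fst.prodMk measurable_snd)).pow_const 2)
  obtain ⟨h1, h2⟩ := integral_fresh hX ha hξ hP hind hψ hint
  simp only at h1 h2
  rw [h2]
  refine integral_mono h1 hint' fun ω => ?_
  simp only [integral_const_mul]
  exact mul_le_mul_of_nonneg_left (hG.integral_sq_le _) (hc0 ω)

/-- The weighted mean of a fresh stochastic gradient. -/
lemma integral_mul_fresh (hG : IsSampleGradient P G h L D₀ D₁) (hX : Measurable X)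
    (ha : Measurable a) (hξ : Measurable ξ)
    (hP : μ.map ξ = P) (hind : IndepFun (fun ω => (X ω, a ω)) ξ μ)
    (hint : Integrable (fun ω => h (X ω) * G (X ω) (ξ ω) * a ω) μ) :
    ∫ ω, h (X ω) * G (X ω) (ξ ω) * a ω ∂μ = ∫ ω, h (X ω) ^ 2 * a ω ∂μ := by
  have hψ : Measurable fun p : (ℝ × ℝ) × Ξ => h p.1.1 * G p.1.1 p.2 * p.1.2 :=
    ((hG.continuous_mean.measurable.comp measurable_fst.fst).mul
      (hG.measurable_uncurry.comp (measurable_fst.fst.prodMk measurable_snd))).mul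
      measurable_fst.snd
  rw [(integral_fresh hX ha hξ hP hind hψ hint).2]
  refine integral_congr_ae (.of_forall fun ω => ?_)
  simp only [integral_mul_const, integral_const_mul, hG.mean]
  ring

end IsSampleGradient

/-! ### Random paths: second moments in terms of those of the gradient -/

/-- Random paths driven by independent samples. -/
structure IsRandomPath {Ω Ξ : Type*} [MeasurableSpace Ω] [MeasurableSpace Ξ] (μ : Measure Ω)
    (P : Measure Ξ) (G : ℝ → Ξ → ℝ) (ξ : ℕ → Ω → Ξ) (A θ η γ β D₀ D₁ : ℝ) (T : ℕ) (h : ℝ → ℝ)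
    (b : ℕ → ℝ) (x r g m a : ℕ → Ω → ℝ) : Prop where
  grad : IsSampleGradient P G h A D₀ D₁
  path : ∀ ω, IsPath A θ η γ β D₀ D₁ T h b (fun t => x t ω) (fun t => G (x t ω) (ξ t ω))
    (fun t => r (t + 1) ω) (fun t => g t ω) (fun t => m t ω) (fun t => a t ω)
  D₁_pos : 0 < D₁
  θ_sq_mul_le : θ ^ 2 * T ≤ 1
  measurable_ξ : ∀ t, Measurable (ξ t)
  law : ∀ t, μ.map (ξ t) = P
  measurable_x : ∀ t, Measurable (x t)
  measurable_g : ∀ t, Measurable (g t)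
  measurable_a : ∀ t, Measurable (a t)
  indep : ∀ t, IndepFun (fun ω => (x t ω, a t ω)) (ξ t) μ
  x_zero : ∀ ω ω', x 0 ω = x 0 ω'
  r_zero : ∀ ω, r 0 ω = 0
  r_succ : ∀ t ω, r (t + 1) ω = β * r t ω + (1 - β) * G (x t ω) (ξ t ω)

/-- Carries integrability and the numerical bound together, as recursions of moments need both at
each step. -/
lemma integrable_and_integral_le {Ω : Type*} [MeasurableSpace Ω] {μ : Measure Ω}
    {f f₁ f₂ : Ω → ℝ} {c₁ c₂ B₁ B₂ : ℝ} (hf : Measurable f) (hf0 : ∀ ω, 0 ≤ f ω)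
    (hle : ∀ ω, f ω ≤ c₁ * f₁ ω + c₂ * f₂ ω) (hc₁ : 0 ≤ c₁) (hc₂ : 0 ≤ c₂)
    (h₁ : Integrable f₁ μ) (h₂ : Integrable f₂ μ) (hB₁ : ∫ ω, f₁ ω ∂μ ≤ B₁)
    (hB₂ : ∫ ω, f₂ ω ∂μ ≤ B₂) :
    Integrable f μ ∧ ∫ ω, f ω ∂μ ≤ c₁ * B₁ + c₂ * B₂ := by
  have hi := (h₁.const_mul c₁).add (h₂.const_mul c₂)
  have hf' : Integrable f μ := by
    refine hi.mono' hf.aestronglyMeasurable (.of_forall fun ω => ?_)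
    rw [Real.norm_eq_abs, abs_of_nonneg (hf0 ω)]
    exact hle ω
  refine ⟨hf', ?_⟩
  calc ∫ ω, f ω ∂μ ≤ ∫ ω, (c₁ * f₁ ω + c₂ * f₂ ω) ∂μ := integral_mono hf' hi hle
    _ = c₁ * ∫ ω, f₁ ω ∂μ + c₂ * ∫ ω, f₂ ω ∂μ := by
      rw [integral_add (h₁.const_mul c₁) (h₂.const_mul c₂), integral_const_mul, integral_const_mul]
    _ ≤ _ := by gcongr

namespace IsRandomPath

variable {Ω Ξ : Type*} [MeasurableSpace Ω] [MeasurableSpace Ξ] {μ : Measure Ω}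
  {P : Measure Ξ} [IsProbabilityMeasure μ] [IsProbabilityMeasure P]
  {G : ℝ → Ξ → ℝ} {ξ : ℕ → Ω → Ξ} {A θ η γ β D₀ D₁ : ℝ} {T : ℕ} {h : ℝ → ℝ}
  {b : ℕ → ℝ} {x r g m a : ℕ → Ω → ℝ} {K : ℕ → ℝ} {N : ℕ}

lemma second_moment_sample (p : IsRandomPath μ P G ξ A θ η γ β D₀ D₁ T h b x r g m a)
    {t : ℕ} {B : ℝ} (hB1 : 1 ≤ B) (hint : Integrable (fun ω => h (x t ω) ^ 2) μ)
    (hB : ∫ ω, h (x t ω) ^ 2 ∂μ ≤ B) :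
    Integrable (fun ω => G (x t ω) (ξ t ω) ^ 2) μ ∧
      ∫ ω, G (x t ω) (ξ t ω) ^ 2 ∂μ ≤ 2 * A * B := by
  have hi := p.grad.integrable_sq_fresh (p.measurable_x t) (p.measurable_a t) (p.measurable_ξ t)
    (p.law t) (p.indep t) hint
  refine ⟨hi, ?_⟩
  have h1 := p.grad.integral_mul_sq_fresh_le (p.measurable_x t) (p.measurable_a t)
    (p.measurable_ξ t) (p.law t) (p.indep t) (c := fun _ => 1) measurable_const
    (fun _ => zero_le_one) (by simpa using hi)
    (by simpa using (integrable_const D₀).add (hint.const_mul D₁))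
  simp only [one_mul] at h1
  rw [integral_add (integrable_const _) (hint.const_mul D₁), integral_const_mul] at h1
  simp only [integral_const, probReal_univ, one_smul] at h1
  obtain ⟨ω⟩ := μ.nonempty_of_neZero
  have q := p.path ω
  have h2 : D₁ * ∫ ω, h (x t ω) ^ 2 ∂μ ≤ A * B :=
    mul_le_mul q.D₁_le hB (integral_nonneg fun _ => sq_nonneg _) q.A_pos.le
  have h3 : D₀ ≤ A * B := q.D₀_le.trans (le_mul_of_one_le_right q.A_pos.le hB1)
  linarith

lemma measurable_sample (p : IsRandomPath μ P G ξ A θ η γ β D₀ D₁ T h b x r g m a) (t : ℕ) :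
    Measurable fun ω => G (x t ω) (ξ t ω) :=
  p.grad.measurable_uncurry.comp ((p.measurable_x t).prodMk (p.measurable_ξ t))

lemma measurable_r (p : IsRandomPath μ P G ξ A θ η γ β D₀ D₁ T h b x r g m a) (t : ℕ) :
    Measurable (r t) := by
  induction t with
  | zero =>
    have : r 0 = fun _ => 0 := funext p.r_zero
    rw [this]; exact measurable_const
  | succ t ih =>
    have : r (t + 1) = fun ω => β * r t ω + (1 - β) * G (x t ω) (ξ t ω) := funext (p.r_succ t)
    rw [this]
    exact (ih.const_mul _).add ((p.measurable_sample t).const_mul _)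

lemma measurable_decayed (p : IsRandomPath μ P G ξ A θ η γ β D₀ D₁ T h b x r g m a) (t : ℕ) :
    Measurable fun ω => decayedSum γ (fun k => |g k ω|) t := by
  induction t with
  | zero => exact measurable_const
  | succ t ih => exact (ih.const_mul γ).add (p.measurable_g t).abs

/-- The update of `r` is a convex combination and the square is convex. Monotonicity of `K` lets the
bound for earlier times serve at the present one. -/
lemma second_moment_r (p : IsRandomPath μ P G ξ A θ η γ β D₀ D₁ T h b x r g m a)
    (hK : Monotone K) (hK1 : ∀ t, 1 ≤ K t)
    (hmom : ∀ t < N, Integrable (fun ω => h (x t ω) ^ 2) μ ∧ ∫ ω, h (x t ω) ^ 2 ∂μ ≤ K t)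
    {t : ℕ} (ht : t < N) :
    Integrable (fun ω => r (t + 1) ω ^ 2) μ ∧ ∫ ω, r (t + 1) ω ^ 2 ∂μ ≤ 2 * A * K t := by
  obtain ⟨ω₀⟩ := μ.nonempty_of_neZero
  have q := p.path ω₀
  have hA := q.A_pos
  have hβ := q.β_nonneg
  have hβ1 : 0 ≤ 1 - β := by linarith [q.β_le, q.γ_lt_one]
  have hle : ∀ t ω, r (t + 1) ω ^ 2 ≤ β * r t ω ^ 2 + (1 - β) * G (x t ω) (ξ t ω) ^ 2 := by
    intro t ω
    rw [p.r_succ]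
    nlinarith [mul_nonneg (mul_nonneg hβ hβ1) (sq_nonneg (r t ω - G (x t ω) (ξ t ω)))]
  induction t with
  | zero =>
    obtain ⟨i, l⟩ := p.second_moment_sample (hK1 0) (hmom 0 ht).1 (hmom 0 ht).2
    have h0 : ∀ ω, r 0 ω ^ 2 = 0 := fun ω => by rw [p.r_zero]; norm_num
    have := integrable_and_integral_le (B₁ := 2 * A * K 0) (μ := μ)
      ((p.measurable_r (0 + 1)).pow_const 2)
      (fun ω => sq_nonneg _) (hle 0) hβ hβ1 (by simp [h0]) i
      (by simp only [h0, integral_zero]; have := hK1 0; positivity) l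
    refine ⟨this.1, this.2.trans (by linarith)⟩
  | succ t ih =>
    obtain ⟨i, l⟩ := p.second_moment_sample (hK1 _) (hmom _ ht).1 (hmom _ ht).2
    obtain ⟨i', l'⟩ := ih (by omega)
    have := integrable_and_integral_le ((p.measurable_r (t + 1 + 1)).pow_const 2)
      (fun ω => sq_nonneg _) (hle (t + 1)) hβ hβ1 i' i
      (l'.trans (mul_le_mul_of_nonneg_left (hK t.le_succ) (by positivity))) l
    exact ⟨this.1, this.2.trans (by linarith)⟩

lemma second_moment_g (p : IsRandomPath μ P G ξ A θ η γ β D₀ D₁ T h b x r g m a)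
    (hK : Monotone K) (hK1 : ∀ t, 1 ≤ K t) (hN : N ≤ T)
    (hmom : ∀ t < N, Integrable (fun ω => h (x t ω) ^ 2) μ ∧ ∫ ω, h (x t ω) ^ 2 ∂μ ≤ K t)
    {t : ℕ} (ht : t < N) :
    Integrable (fun ω => g t ω ^ 2) μ ∧ ∫ ω, g t ω ^ 2 ∂μ ≤ 8 * A ^ 11 * K t := by
  obtain ⟨ω₀⟩ := μ.nonempty_of_neZero
  have q := p.path ω₀
  have hA := q.A_pos
  have hA1 := q.one_le_A
  have hKt := hK1 t
  obtain ⟨i, l⟩ := p.second_moment_sample (hK1 t) (hmom t ht).1 (hmom t ht).2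
  obtain ⟨i', l'⟩ := p.second_moment_r hK hK1 hmom ht
  have hle : ∀ ω, g t ω ^ 2 ≤ 2 * A ^ 10 * G (x t ω) (ξ t ω) ^ 2
      + 2 * A ^ 10 * r (t + 1) ω ^ 2 := by
    intro ω
    have q' := p.path ω
    have h1 := q'.g_sub t (by omega)
    have hθ := q.θ_nonneg
    have h2 : (g t ω - b t * G (x t ω) (ξ t ω)) ^ 2 ≤ A ^ 10 * r (t + 1) ω ^ 2 := by
      rw [← sq_abs]
      calc |g t ω - b t * G (x t ω) (ξ t ω)| ^ 2 ≤ (A ^ 5 * 1 * |r (t + 1) ω|) ^ 2 := by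
            gcongr
            refine h1.trans ?_
            gcongr
            exact q.θ_le
        _ = A ^ 10 * r (t + 1) ω ^ 2 := by rw [mul_pow, sq_abs]; ring
    have h3 : (b t * G (x t ω) (ξ t ω)) ^ 2 ≤ A ^ 10 * G (x t ω) (ξ t ω) ^ 2 := by
      rw [mul_pow]
      have hb := q.one_le_b t (by omega)
      calc b t ^ 2 * G (x t ω) (ξ t ω) ^ 2 ≤ A ^ 2 * G (x t ω) (ξ t ω) ^ 2 := by
            gcongr
            exact q.b_le t (by omega)
        _ ≤ _ := by gcongr; norm_num
    nlinarith [sq_nonneg (g t ω - b t * G (x t ω) (ξ t ω) - b t * G (x t ω) (ξ t ω))]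
  have := integrable_and_integral_le ((p.measurable_g t).pow_const 2)
    (fun ω => sq_nonneg _) hle (by positivity) (by positivity) i i' l l'
  exact ⟨this.1, this.2.trans (by ring_nf; rfl)⟩

lemma second_moment_decayed (p : IsRandomPath μ P G ξ A θ η γ β D₀ D₁ T h b x r g m a)
    (hK : Monotone K) (hK1 : ∀ t, 1 ≤ K t) (hN : N ≤ T)
    (hmom : ∀ t < N, Integrable (fun ω => h (x t ω) ^ 2) μ ∧ ∫ ω, h (x t ω) ^ 2 ∂μ ≤ K t)
    {t : ℕ} (ht : t < N) :
    Integrable (fun ω => decayedSum γ (fun k => |g k ω|) (t + 1) ^ 2) μ ∧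
      ∫ ω, decayedSum γ (fun k => |g k ω|) (t + 1) ^ 2 ∂μ ≤ 8 * A ^ 13 * K t := by
  obtain ⟨ω₀⟩ := μ.nonempty_of_neZero
  have q := p.path ω₀
  have hA := q.A_pos
  have hγ := q.γ_nonneg
  have hγ1 : 0 < 1 - γ := by linarith [q.γ_lt_one]
  have hle : ∀ t ω, decayedSum γ (fun k => |g k ω|) (t + 1) ^ 2
      ≤ γ * decayedSum γ (fun k => |g k ω|) t ^ 2 + A * g t ω ^ 2 := by
    intro t ω
    simp only [decayedSum]
    generalize decayedSum γ (fun k => |g k ω|) t = M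
    -- Convexity: `γ * M + g` is the combination of `M` and `g / (1 - γ)` with weights `γ` and `1 -
    -- γ`.
    have e : γ * M ^ 2 + 1 / (1 - γ) * |g t ω| ^ 2 - (γ * M + |g t ω|) ^ 2
        = γ / (1 - γ) * ((1 - γ) * M - |g t ω|) ^ 2 := by
      field_simp; ring
    have h1 : 0 ≤ γ / (1 - γ) * ((1 - γ) * M - |g t ω|) ^ 2 := by positivity
    have h2 : 1 / (1 - γ) * |g t ω| ^ 2 ≤ A * |g t ω| ^ 2 := by
      gcongr
      exact q.inv_gap_le
    rw [sq_abs] at h2 e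
    linarith
  have hfin : ∀ k, 1 ≤ k → γ * (8 * A ^ 13 * k) + A * (8 * A ^ 11 * k) ≤ 8 * A ^ 13 * k := by
    intro k hk
    have := mul_le_mul_of_nonneg_left q.gap (by positivity : 0 ≤ 8 * A ^ 12 * k)
    linarith
  induction t with
  | zero =>
    obtain ⟨i, l⟩ := p.second_moment_g hK hK1 hN hmom ht
    have hK0 := hK1 0
    have := integrable_and_integral_le (B₁ := 8 * A ^ 13 * K 0) (μ := μ)
      ((p.measurable_decayed (0 + 1)).pow_const 2)
      (fun ω => sq_nonneg _) (hle 0) hγ hA.le (by simp [decayedSum]) i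
      (by simp only [decayedSum]; simp; positivity) l
    exact ⟨this.1, this.2.trans (hfin _ hK0)⟩
  | succ t ih =>
    obtain ⟨i, l⟩ := p.second_moment_g hK hK1 hN hmom ht
    obtain ⟨i', l'⟩ := ih (by omega)
    have := integrable_and_integral_le ((p.measurable_decayed (t + 1 + 1)).pow_const 2)
      (fun ω => sq_nonneg _) (hle (t + 1)) hγ hA.le i' i
      (l'.trans (mul_le_mul_of_nonneg_left (hK t.le_succ) (by positivity))) l
    exact ⟨this.1, this.2.trans (hfin _ (hK1 _))⟩

lemma expected_energy (p : IsRandomPath μ P G ξ A θ η γ β D₀ D₁ T h b x r g m a)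
    (hK : Monotone K) (hK1 : ∀ t, 1 ≤ K t) (hN : N ≤ T)
    (hmom : ∀ t < N, Integrable (fun ω => h (x t ω) ^ 2) μ ∧ ∫ ω, h (x t ω) ^ 2 ∂μ ≤ K t)
    {t : ℕ} (ht : t < N) :
    Integrable (fun ω => energy γ h (fun t => x t ω) (fun t => r (t + 1) ω) (fun t => g t ω) t) μ ∧
      ∫ ω, energy γ h (fun t => x t ω) (fun t => r (t + 1) ω) (fun t => g t ω) t ∂μ
        ≤ 11 * A ^ 13 * K t := by
  obtain ⟨ω₀⟩ := μ.nonempty_of_neZero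
  have q := p.path ω₀
  have hA := q.one_le_A
  have hKt := hK1 t
  obtain ⟨i₁, l₁⟩ := hmom t ht
  obtain ⟨i₂, l₂⟩ := p.second_moment_decayed hK hK1 hN hmom ht
  obtain ⟨i₃, l₃⟩ := p.second_moment_r hK hK1 hmom ht
  refine ⟨(i₁.add i₂).add i₃, ?_⟩
  have e : ∫ ω, energy γ h (fun t => x t ω) (fun t => r (t + 1) ω) (fun t => g t ω) t ∂μ
      = ∫ ω, h (x t ω) ^ 2 ∂μ + ∫ ω, decayedSum γ (fun k => |g k ω|) (t + 1) ^ 2 ∂μ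
        + ∫ ω, r (t + 1) ω ^ 2 ∂μ := by
    rw [← integral_add i₁ i₂]
    exact integral_add (i₁.add i₂) i₃
  rw [e]
  have h1 : 1 * K t ≤ A ^ 13 * K t := by gcongr; exact one_le_pow₀ hA
  have h2 : A * K t ≤ A ^ 13 * K t := by gcongr; exact le_self_pow₀ hA (by norm_num)
  linarith

end IsRandomPath

/-! ### Expected descent, the Gronwall argument and the scalar rate -/

namespace IsRandomPath

variable {Ω Ξ : Type*} [MeasurableSpace Ω] [MeasurableSpace Ξ] {μ : Measure Ω}
  {P : Measure Ξ} [IsProbabilityMeasure μ] [IsProbabilityMeasure P]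
  {G : ℝ → Ξ → ℝ} {ξ : ℕ → Ω → Ξ} {A θ η γ β D₀ D₁ : ℝ} {T : ℕ} {h : ℝ → ℝ}
  {b : ℕ → ℝ} {x r g m a : ℕ → Ω → ℝ} {K : ℕ → ℝ} {N : ℕ}

lemma measurable_h (p : IsRandomPath μ P G ξ A θ η γ β D₀ D₁ T h b x r g m a) (t : ℕ) :
    Measurable fun ω => h (x t ω) :=
  p.grad.continuous_mean.measurable.comp (p.measurable_x t)

lemma integrable_sq_mul_stepsize (p : IsRandomPath μ P G ξ A θ η γ β D₀ D₁ T h b x r g m a)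
    {t : ℕ} (hint : Integrable (fun ω => h (x t ω) ^ 2) μ) :
    Integrable (fun ω => h (x t ω) ^ 2 * a t ω) μ := by
  refine hint.mul_bdd (c := A) (p.measurable_a t).aestronglyMeasurable (.of_forall fun ω => ?_)
  rw [Real.norm_eq_abs, abs_of_nonneg ((p.path ω).a_nonneg t)]
  exact (p.path ω).a_le t

lemma cross_moment (p : IsRandomPath μ P G ξ A θ η γ β D₀ D₁ T h b x r g m a)
    {t : ℕ} (hint : Integrable (fun ω => h (x t ω) ^ 2) μ) :
    Integrable (fun ω => h (x t ω) * G (x t ω) (ξ t ω) * a t ω) μ ∧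
      ∫ ω, h (x t ω) * G (x t ω) (ξ t ω) * a t ω ∂μ = ∫ ω, h (x t ω) ^ 2 * a t ω ∂μ := by
  have hs := p.grad.integrable_sq_fresh (p.measurable_x t) (p.measurable_a t) (p.measurable_ξ t)
    (p.law t) (p.indep t) hint
  have hi : Integrable (fun ω => h (x t ω) * G (x t ω) (ξ t ω)) μ := by
    refine (hint.add hs).mono'
      ((p.measurable_h t).mul (p.measurable_sample t)).aestronglyMeasurable
      (.of_forall fun ω => ?_)
    rw [Real.norm_eq_abs, abs_mul]
    simp only [Pi.add_apply]
    nlinarith [sq_nonneg (|h (x t ω)| - |G (x t ω) (ξ t ω)|), sq_abs (h (x t ω)),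
      sq_abs (G (x t ω) (ξ t ω)), sq_nonneg (h (x t ω)), sq_nonneg (G (x t ω) (ξ t ω))]
  have hi' : Integrable (fun ω => h (x t ω) * G (x t ω) (ξ t ω) * a t ω) μ := by
    refine hi.mul_bdd (c := A) (p.measurable_a t).aestronglyMeasurable (.of_forall fun ω => ?_)
    rw [Real.norm_eq_abs, abs_of_nonneg ((p.path ω).a_nonneg t)]
    exact (p.path ω).a_le t
  exact ⟨hi', p.grad.integral_mul_fresh (p.measurable_x t) (p.measurable_a t) (p.measurable_ξ t)
    (p.law t) (p.indep t) hi'⟩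

/-- The mean square of the fresh sample is at most `D₀ + D₁ * h ^ 2`, exactly the denominator of
`normalized`. -/
lemma normalized_moment (p : IsRandomPath μ P G ξ A θ η γ β D₀ D₁ T h b x r g m a)
    {t : ℕ} (hint : Integrable (fun ω => h (x t ω) ^ 2) μ) :
    Integrable (fun ω => normalized D₀ D₁ h (fun t => x t ω) (fun t => G (x t ω) (ξ t ω))
        (fun t => a t ω) t) μ ∧
      ∫ ω, normalized D₀ D₁ h (fun t => x t ω) (fun t => G (x t ω) (ξ t ω))
        (fun t => a t ω) t ∂μ ≤ ∫ ω, h (x t ω) ^ 2 * a t ω ∂μ := by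
  obtain ⟨ω₀⟩ := μ.nonempty_of_neZero
  have hD0 := (p.path ω₀).D₀_pos
  have hD1 := p.D₁_pos
  have hA := (p.path ω₀).A_pos
  have hs := p.grad.integrable_sq_fresh (p.measurable_x t) (p.measurable_a t) (p.measurable_ξ t)
    (p.law t) (p.indep t) hint
  set c : ℝ × ℝ → ℝ := fun z => h z.1 ^ 2 / (D₀ + D₁ * h z.1 ^ 2) * z.2 with hc
  have hh : Measurable fun z : ℝ × ℝ => h z.1 ^ 2 :=
    (p.grad.continuous_mean.measurable.comp measurable_fst).pow_const 2
  have hcm : Measurable c := (hh.div ((hh.const_mul D₁).const_add D₀)).mul measurable_snd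
  have hc0 : ∀ ω, 0 ≤ c (x t ω, a t ω) := fun ω => by
    have := (p.path ω).a_nonneg t
    simp only [hc]
    positivity
  have e1 : (fun ω => normalized D₀ D₁ h (fun t => x t ω) (fun t => G (x t ω) (ξ t ω))
      (fun t => a t ω) t) = fun ω => c (x t ω, a t ω) * G (x t ω) (ξ t ω) ^ 2 := by
    funext ω
    simp only [normalized, hc]
    ring
  have e2 : (fun ω => c (x t ω, a t ω) * (D₀ + D₁ * h (x t ω) ^ 2))
      = fun ω => h (x t ω) ^ 2 * a t ω := by
    funext ω
    have : D₀ + D₁ * h (x t ω) ^ 2 ≠ 0 := by positivity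
    simp only [hc]
    field_simp
  -- `D₁ > 0` bounds the weight `h ^ 2 / (D₀ + D₁ * h ^ 2)` by `1 / D₁`.
  have hi : Integrable (fun ω => c (x t ω, a t ω) * G (x t ω) (ξ t ω) ^ 2) μ := by
    refine hs.bdd_mul (c := 1 / D₁ * A)
      (hcm.comp ((p.measurable_x t).prodMk (p.measurable_a t))).aestronglyMeasurable
      (.of_forall fun ω => ?_)
    rw [Real.norm_eq_abs, abs_of_nonneg (hc0 ω)]
    simp only [hc]
    refine mul_le_mul ?_ ((p.path ω).a_le t) ((p.path ω).a_nonneg t) (by positivity)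
    rw [div_le_div_iff₀ (by positivity) hD1]
    linarith
  rw [e1, ← e2]
  exact ⟨hi, p.grad.integral_mul_sq_fresh_le (p.measurable_x t) (p.measurable_a t)
    (p.measurable_ξ t) (p.law t) (p.indep t) hcm hc0 hi
    (by rw [e2]; exact p.integrable_sq_mul_stepsize hint)⟩

/-- The expected accumulated descent inequality. -/
lemma expected_descent (p : IsRandomPath μ P G ξ A θ η γ β D₀ D₁ T h b x r g m a)
    {φ : ℝ → ℝ} (hφ : ∀ x, HasDerivAt φ (h x) x) (hb : ∀ ω y, φ (x 0 ω) - φ y ≤ A)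
    (hK : Monotone K) (hK1 : ∀ t, 1 ≤ K t) (hN : N ≤ T)
    (hmom : ∀ t < N, Integrable (fun ω => h (x t ω) ^ 2) μ ∧ ∫ ω, h (x t ω) ^ 2 ∂μ ≤ K t) :
    Integrable (fun ω => h (x N ω) ^ 2) μ ∧
      (∫ ω, h (x N ω) ^ 2 ∂μ) / (8 * A)
          + η / 2 * ∑ t ∈ Finset.range N, ∫ ω, h (x t ω) ^ 2 * a t ω ∂μ
        ≤ 6 * A ^ 11 + 132 * A ^ 29 * (θ ^ 2 * ∑ t ∈ Finset.range N, K t) := by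
  obtain ⟨ω₀⟩ := μ.nonempty_of_neZero
  have q := p.path ω₀
  have hA := q.A_pos
  have hη := q.η_nonneg
  have hint : Integrable (fun ω => h (x N ω) ^ 2) μ := by
    rcases N with _ | n
    · have : (fun ω => h (x 0 ω) ^ 2) = fun _ => h (x 0 ω₀) ^ 2 :=
        funext fun ω => by rw [p.x_zero ω ω₀]
      rw [this]
      exact integrable_const _
    · have hn := hmom n n.lt_succ_self
      have hE := p.expected_energy hK hK1 hN hmom n.lt_succ_self
      refine (integrable_and_integral_le (c₁ := 1) (c₂ := 2 * A ^ 6 * θ)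
        ((p.measurable_h (n + 1)).pow_const 2) (fun ω => sq_nonneg _)
        (fun ω => ?_) zero_le_one ?_ hn.1 hE.1 hn.2 hE.2).1
      · have := (abs_le.1 ((p.path ω).abs_sq_h_succ_sub_le n)).2
        linarith
      · have := q.θ_nonneg
        positivity
  refine ⟨hint, ?_⟩
  set κ := (1 - β) / (1 - γ) with hκ
  have hκ1 : 1 ≤ κ := by
    rw [hκ, one_le_div (by linarith [q.γ_lt_one])]
    linarith [q.β_le]
  have hcr : ∀ t ∈ Finset.range N,
      Integrable (fun ω => b t * (h (x t ω) * G (x t ω) (ξ t ω) * a t ω)) μ := fun t ht =>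
    (p.cross_moment (hmom t (Finset.mem_range.1 ht)).1).1.const_mul _
  have hno : ∀ t ∈ Finset.range N,
      Integrable (fun ω => normalized D₀ D₁ h (fun t => x t ω) (fun t => G (x t ω) (ξ t ω))
        (fun t => a t ω) t) μ := fun t ht =>
    (p.normalized_moment (hmom t (Finset.mem_range.1 ht)).1).1
  have hen : ∀ t ∈ Finset.range N,
      Integrable (fun ω => energy γ h (fun t => x t ω) (fun t => r (t + 1) ω)
        (fun t => g t ω) t) μ := fun t ht =>
    (p.expected_energy hK hK1 hN hmom (Finset.mem_range.1 ht)).1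
  have hcr' := integrable_finsetSum _ hcr
  have hno' := integrable_finsetSum _ hno
  have hen' := integrable_finsetSum _ hen
  have main : ∫ ω, (h (x N ω) ^ 2 / (8 * A)
      + η * κ * ∑ t ∈ Finset.range N, b t * (h (x t ω) * G (x t ω) (ξ t ω) * a t ω)) ∂μ
      ≤ ∫ ω, (η / 2 * ∑ t ∈ Finset.range N, normalized D₀ D₁ h (fun t => x t ω)
          (fun t => G (x t ω) (ξ t ω)) (fun t => a t ω) t + 6 * A ^ 11
        + 12 * A ^ 16 * θ ^ 2 * ∑ t ∈ Finset.range N, energy γ h (fun t => x t ω)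
          (fun t => r (t + 1) ω) (fun t => g t ω) t) ∂μ :=
    integral_mono ((hint.div_const _).add (hcr'.const_mul _))
      (((hno'.const_mul _).add (integrable_const _)).add (hen'.const_mul _))
      fun ω => (p.path ω).accumulated_gradient_bound hφ (hb ω) hN
  rw [integral_add (hint.div_const _) (hcr'.const_mul _),
    integral_add ((hno'.const_mul _).fun_add (integrable_const _)) (hen'.const_mul _),
    integral_add (hno'.const_mul _) (integrable_const _), integral_const, integral_div,
    integral_const_mul,
    integral_const_mul, integral_const_mul, integral_finsetSum _ hcr, integral_finsetSum _ hno,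
    integral_finsetSum _ hen] at main
  simp only [probReal_univ, one_smul] at main
  have hpos : ∀ t, 0 ≤ ∫ ω, h (x t ω) ^ 2 * a t ω ∂μ := fun t =>
    integral_nonneg fun ω => mul_nonneg (sq_nonneg _) ((p.path ω).a_nonneg t)
  have l1 : ∑ t ∈ Finset.range N, ∫ ω, h (x t ω) ^ 2 * a t ω ∂μ
      ≤ ∑ t ∈ Finset.range N, ∫ ω, b t * (h (x t ω) * G (x t ω) (ξ t ω) * a t ω) ∂μ := by
    refine Finset.sum_le_sum fun t ht => ?_
    have ht' := Finset.mem_range.1 ht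
    rw [integral_const_mul, (p.cross_moment (hmom t ht').1).2]
    exact le_mul_of_one_le_left (hpos t) (q.one_le_b t (by omega))
  have l2 : ∑ t ∈ Finset.range N, ∫ ω, normalized D₀ D₁ h (fun t => x t ω)
        (fun t => G (x t ω) (ξ t ω)) (fun t => a t ω) t ∂μ
      ≤ ∑ t ∈ Finset.range N, ∫ ω, h (x t ω) ^ 2 * a t ω ∂μ :=
    Finset.sum_le_sum fun t ht => (p.normalized_moment (hmom t (Finset.mem_range.1 ht)).1).2
  have l3 : ∑ t ∈ Finset.range N, ∫ ω, energy γ h (fun t => x t ω) (fun t => r (t + 1) ω)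
        (fun t => g t ω) t ∂μ ≤ 11 * A ^ 13 * ∑ t ∈ Finset.range N, K t := by
    rw [Finset.mul_sum]
    exact Finset.sum_le_sum fun t ht =>
      (p.expected_energy hK hK1 hN hmom (Finset.mem_range.1 ht)).2
  have hS : 0 ≤ ∑ t ∈ Finset.range N, ∫ ω, h (x t ω) ^ 2 * a t ω ∂μ :=
    Finset.sum_nonneg fun t _ => hpos t
  -- The descent term has coefficient at least `η`, because `κ` and `b t` are at least 1; the
  -- normalized moments use up `η / 2` of it.
  have k1 : η * 1 * ∑ t ∈ Finset.range N, ∫ ω, h (x t ω) ^ 2 * a t ω ∂μ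
      ≤ η * κ * ∑ t ∈ Finset.range N, ∫ ω, b t * (h (x t ω) * G (x t ω) (ξ t ω) * a t ω) ∂μ := by
    gcongr
  have k2 := mul_le_mul_of_nonneg_left l2 (by positivity : 0 ≤ η / 2)
  have k3 := mul_le_mul_of_nonneg_left l3 (by positivity : 0 ≤ 12 * A ^ 16 * θ ^ 2)
  linarith

/-- The growth factor of the second moments of the gradients. -/
noncomputable def momentBound (A θ : ℝ) (t : ℕ) : ℝ :=
  48 * A ^ 12 * (1 + 1056 * A ^ 30 * θ ^ 2) ^ t

/-- `momentBound` solves with equality the recursion that `expected_descent` gives after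
multiplication by `8 * A`: hence the constants 48 = 8 * 6 and 1056 = 8 * 132. -/
lemma momentBound_eq (A θ : ℝ) (N : ℕ) :
    momentBound A θ N
      = 48 * A ^ 12 + 1056 * A ^ 30 * (θ ^ 2 * ∑ t ∈ Finset.range N, momentBound A θ t) := by
  induction N with
  | zero => simp [momentBound]
  | succ N ih =>
    rw [Finset.sum_range_succ, mul_add, mul_add, ← add_assoc, ← ih]
    simp only [momentBound]
    ring

lemma momentBound_mono {A : ℝ} (hA : 1 ≤ A) (θ : ℝ) : Monotone (momentBound A θ) := by
  refine monotone_nat_of_le_succ fun t => ?_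
  unfold momentBound
  have : 0 ≤ A := by linarith
  gcongr
  · have : 0 ≤ 1056 * A ^ 30 * θ ^ 2 := by positivity
    linarith
  · omega

lemma one_le_momentBound {A : ℝ} (hA : 1 ≤ A) (θ : ℝ) (t : ℕ) : 1 ≤ momentBound A θ t := by
  refine le_trans ?_ (momentBound_mono hA θ t.zero_le)
  have : 1 ≤ A ^ 12 := one_le_pow₀ hA
  simp only [momentBound, pow_zero]
  linarith

lemma momentBound_le {A θ : ℝ} {T : ℕ} (hA : 1 ≤ A) (hT : θ ^ 2 * T ≤ 1) {t : ℕ} (ht : t ≤ T) :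
    momentBound A θ t ≤ 48 * A ^ 12 * Real.exp (1056 * A ^ 30) := by
  have h0 : 0 ≤ 1056 * A ^ 30 * θ ^ 2 := by positivity
  have hA0 : 0 ≤ A := by linarith
  unfold momentBound
  gcongr
  calc (1 + 1056 * A ^ 30 * θ ^ 2) ^ t ≤ (Real.exp (1056 * A ^ 30 * θ ^ 2)) ^ t := by
        gcongr
        linarith [Real.add_one_le_exp (1056 * A ^ 30 * θ ^ 2)]
    _ = Real.exp (1056 * A ^ 30 * (θ ^ 2 * t)) := by rw [← Real.exp_nat_mul]; ring_nf
    _ ≤ Real.exp (1056 * A ^ 30 * 1) := by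
        gcongr
        refine le_trans ?_ hT
        gcongr
    _ = _ := by rw [mul_one]

/-- The second moments of the gradients stay bounded. -/
lemma second_moment_gradient (p : IsRandomPath μ P G ξ A θ η γ β D₀ D₁ T h b x r g m a)
    {φ : ℝ → ℝ} (hφ : ∀ x, HasDerivAt φ (h x) x) (hb : ∀ ω y, φ (x 0 ω) - φ y ≤ A)
    {t : ℕ} (ht : t ≤ T) :
    Integrable (fun ω => h (x t ω) ^ 2) μ ∧ ∫ ω, h (x t ω) ^ 2 ∂μ ≤ momentBound A θ t := by
  obtain ⟨ω₀⟩ := μ.nonempty_of_neZero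
  have q := p.path ω₀
  have hA := q.A_pos
  induction t using Nat.strong_induction_on with
  | _ t ih =>
    -- The bounds at all times before `t` feed the energies; the term `h (x t) ^ 2` of the resulting
    -- inequality gives the bound at `t`.
    obtain ⟨hi, hle⟩ := p.expected_descent hφ hb (momentBound_mono q.one_le_A θ)
      (one_le_momentBound q.one_le_A θ) ht fun k hk => ih k hk (by omega)
    refine ⟨hi, ?_⟩
    have hS : 0 ≤ ∑ k ∈ Finset.range t, ∫ ω, h (x k ω) ^ 2 * a k ω ∂μ :=
      Finset.sum_nonneg fun k _ =>
        integral_nonneg fun ω => mul_nonneg (sq_nonneg _) ((p.path ω).a_nonneg k)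
    have hS' := mul_nonneg (by linarith [q.η_nonneg] : 0 ≤ η / 2) hS
    have h1 : (∫ ω, h (x t ω) ^ 2 ∂μ) / (8 * A) ≤ 6 * A ^ 11
        + 132 * A ^ 29 * (θ ^ 2 * ∑ k ∈ Finset.range t, momentBound A θ k) := by linarith
    rw [div_le_iff₀ (by positivity)] at h1
    rw [momentBound_eq]
    linarith

/-- A bound, in terms of `A` alone, for the accumulated quantities. -/
noncomputable def totalBound (A : ℝ) : ℝ :=
  1 + 3 * A + 12 * A ^ 12 + 300 * A ^ 30 * (48 * A ^ 12 * Real.exp (1056 * A ^ 30))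

lemma sum_momentBound_le {A θ : ℝ} {T N : ℕ} (hA : 1 ≤ A) (hT : θ ^ 2 * T ≤ 1) (hN : N ≤ T) :
    θ ^ 2 * ∑ t ∈ Finset.range N, momentBound A θ t
      ≤ 48 * A ^ 12 * Real.exp (1056 * A ^ 30) := by
  have hA0 : 0 ≤ A := by linarith
  calc θ ^ 2 * ∑ t ∈ Finset.range N, momentBound A θ t
      ≤ θ ^ 2 * ∑ _t ∈ Finset.range N, 48 * A ^ 12 * Real.exp (1056 * A ^ 30) := by
        gcongr with t ht
        have := Finset.mem_range.1 ht
        exact momentBound_le hA hT (by omega)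
    _ = (θ ^ 2 * N) * (48 * A ^ 12 * Real.exp (1056 * A ^ 30)) := by
        rw [Finset.sum_const, Finset.card_range, nsmul_eq_mul]; ring
    _ ≤ 1 * (48 * A ^ 12 * Real.exp (1056 * A ^ 30)) := by
        gcongr
        refine le_trans ?_ hT
        gcongr
    _ = _ := one_mul _

/-- Here the weighted sum of `expected_descent` at `N = T` is kept and the last gradient dropped; `θ
≤ A * η` trades `η` for `θ`. -/
lemma sum_weighted_le (p : IsRandomPath μ P G ξ A θ η γ β D₀ D₁ T h b x r g m a)
    {φ : ℝ → ℝ} (hφ : ∀ x, HasDerivAt φ (h x) x) (hb : ∀ ω y, φ (x 0 ω) - φ y ≤ A)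
    (hη : θ ≤ A * η) :
    θ * ∑ t ∈ Finset.range T, ∫ ω, h (x t ω) ^ 2 * a t ω ∂μ ≤ totalBound A := by
  obtain ⟨ω₀⟩ := μ.nonempty_of_neZero
  have q := p.path ω₀
  have hA := q.one_le_A
  have hA0 := q.A_pos
  have h1 := (p.expected_descent hφ hb (momentBound_mono q.one_le_A θ)
      (one_le_momentBound q.one_le_A θ) le_rfl
      fun k hk => p.second_moment_gradient hφ hb hk.le).2
  have h2 := sum_momentBound_le hA p.θ_sq_mul_le le_rfl
  have h3 : 0 ≤ (∫ ω, h (x T ω) ^ 2 ∂μ) / (8 * A) :=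
    div_nonneg (integral_nonneg fun _ => sq_nonneg _) (by positivity)
  have hS : 0 ≤ ∑ k ∈ Finset.range T, ∫ ω, h (x k ω) ^ 2 * a k ω ∂μ :=
      Finset.sum_nonneg fun k _ =>
        integral_nonneg fun ω => mul_nonneg (sq_nonneg _) ((p.path ω).a_nonneg k)
  have h4 := mul_le_mul_of_nonneg_left h2 (by positivity : 0 ≤ 132 * A ^ 29)
  have h5 := mul_le_mul_of_nonneg_right hη hS
  set E := 48 * A ^ 12 * Real.exp (1056 * A ^ 30) with hE
  have hE0 : 0 ≤ E := by positivity
  have h6 : η * ∑ k ∈ Finset.range T, ∫ ω, h (x k ω) ^ 2 * a k ω ∂μ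
      ≤ 12 * A ^ 11 + 264 * A ^ 29 * E := by linarith
  have h7 := mul_le_mul_of_nonneg_left h6 hA0.le
  have h8 : 0 ≤ A ^ 30 * E := by positivity
  unfold totalBound
  rw [← hE]
  linarith

/-- The expected gradients along a random path. -/
theorem sum_expected_gradient_le (p : IsRandomPath μ P G ξ A θ η γ β D₀ D₁ T h b x r g m a)
    {φ : ℝ → ℝ} (hφ : ∀ x, HasDerivAt φ (h x) x) (hb : ∀ ω y, φ (x 0 ω) - φ y ≤ A)
    (hη : θ ≤ A * η) {α τ : ℝ} {V : ℕ → Ω → ℝ} (hα : 0 ≤ α) (hα' : α ≤ A * θ ^ 2)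
    (hV0 : ∀ ω, V 0 ω ≤ A) (hVm : ∀ t, Measurable (V t)) (hVpos : ∀ t ω, 0 ≤ V t ω)
    (hV : ∀ t ω, V (t + 1) ω = V t ω + α * g t ω ^ 2)
    (hVa : ∀ t ω, 1 ≤ a t ω * (1 + V t ω)) (hτ : 0 < τ) :
    (∀ t < T, Integrable (fun ω => |h (x t ω)|) μ) ∧
      θ * ∑ t ∈ Finset.range T, ∫ ω, |h (x t ω)| ∂μ
        ≤ totalBound A * (τ + θ * T / τ) := by
  obtain ⟨ω₀⟩ := μ.nonempty_of_neZero
  have q := p.path ω₀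
  have hA := q.one_le_A
  have hA0 := q.A_pos
  have hθ := q.θ_nonneg
  have hT := p.θ_sq_mul_le
  set E := 48 * A ^ 12 * Real.exp (1056 * A ^ 30) with hE
  have hE0 : 0 ≤ E := by positivity
  have hmom : ∀ t < T, Integrable (fun ω => h (x t ω) ^ 2) μ ∧
      ∫ ω, h (x t ω) ^ 2 ∂μ ≤ momentBound A θ t := fun t ht =>
    p.second_moment_gradient hφ hb ht.le
  -- `V` grows by `α * g ^ 2` with `α ≤ A * θ ^ 2`, so the uniform second moments keep its mean
  -- bounded up to time `T`.
  have hVint : ∀ t ≤ T, Integrable (V t) μ ∧ ∫ ω, V t ω ∂μ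
      ≤ A + α * ∑ k ∈ Finset.range t, 8 * A ^ 11 * momentBound A θ k := by
    intro t
    induction t with
    | zero =>
      intro _
      have hi : Integrable (V 0) μ := by
        refine (integrable_const A).mono' (hVm 0).aestronglyMeasurable (.of_forall fun ω => ?_)
        rw [Real.norm_eq_abs, abs_of_nonneg (hVpos 0 ω)]
        exact hV0 ω
      refine ⟨hi, ?_⟩
      have := integral_mono hi (integrable_const A) hV0
      simpa using this
    | succ t ih =>
      intro ht
      obtain ⟨i, l⟩ := ih (by omega)
      obtain ⟨i', l'⟩ := p.second_moment_g (momentBound_mono hA θ) (one_le_momentBound hA θ)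
        le_rfl hmom (by omega : t < T)
      have := integrable_and_integral_le (c₁ := 1) (c₂ := α) (hVm (t + 1)) (hVpos (t + 1))
        (fun ω => by rw [hV, one_mul]) zero_le_one hα i i' l l'
      refine ⟨this.1, this.2.trans ?_⟩
      rw [Finset.sum_range_succ]
      linarith
  have hVle : ∀ t < T, ∫ ω, (1 + V t ω) ∂μ ≤ totalBound A := by
    intro t ht
    obtain ⟨i, l⟩ := hVint t ht.le
    rw [integral_add (integrable_const _) i]
    simp only [integral_const, probReal_univ, one_smul]
    have h1 := sum_momentBound_le hA hT ht.le
    have hS : 0 ≤ ∑ k ∈ Finset.range t, momentBound A θ k :=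
      Finset.sum_nonneg fun k _ => zero_le_one.trans (one_le_momentBound hA θ k)
    rw [← Finset.mul_sum] at l
    have h2 : α * (8 * A ^ 11 * ∑ k ∈ Finset.range t, momentBound A θ k)
        ≤ A * θ ^ 2 * (8 * A ^ 11 * ∑ k ∈ Finset.range t, momentBound A θ k) := by gcongr
    have h3 := mul_le_mul_of_nonneg_left h1 (by positivity : 0 ≤ 8 * A ^ 12)
    rw [← hE] at h3
    have h4 : A ^ 12 * E ≤ A ^ 30 * E := by gcongr; norm_num
    have h5 : 0 ≤ A ^ 30 * E := by positivity
    unfold totalBound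
    rw [← hE]
    have h6 : 0 ≤ A ^ 12 := by positivity
    linarith
  -- Young's inequality `2 * |h| ≤ τ * h ^ 2 * a + 1 / (τ * a)` together with `1 / a ≤ 1 + V`.
  have hpt : ∀ t ω, |h (x t ω)| ≤ τ * (h (x t ω) ^ 2 * a t ω) + 1 / τ * (1 + V t ω) := by
    intro t ω
    have h1 := hVa t ω
    have h2 := hVpos t ω
    have ha : 0 < a t ω := by
      by_contra hc
      have := (p.path ω).a_nonneg t
      have : a t ω = 0 := le_antisymm (not_lt.1 hc) this
      rw [this] at h1
      linarith
    have h3 : 1 / τ * (1 / a t ω) ≤ 1 / τ * (1 + V t ω) := by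
      gcongr
      rw [div_le_iff₀ ha]
      linarith
    have e : τ * (h (x t ω) ^ 2 * a t ω) + 1 / τ * (1 / a t ω) - 2 * |h (x t ω)|
        = 1 / (τ * a t ω) * (τ * a t ω * |h (x t ω)| - 1) ^ 2 := by
      rw [← sq_abs (h (x t ω))]
      field_simp
      ring
    have h4 : 0 ≤ 1 / (τ * a t ω) * (τ * a t ω * |h (x t ω)| - 1) ^ 2 := by positivity
    linarith [abs_nonneg (h (x t ω))]
  have hfin : ∀ t < T, Integrable (fun ω => |h (x t ω)|) μ ∧ ∫ ω, |h (x t ω)| ∂μ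
      ≤ τ * ∫ ω, h (x t ω) ^ 2 * a t ω ∂μ + 1 / τ * totalBound A := fun t ht =>
    integrable_and_integral_le (p.measurable_h t).abs (fun ω => abs_nonneg _) (hpt t) hτ.le
      (by positivity) (p.integrable_sq_mul_stepsize (hmom t ht).1)
      ((integrable_const 1).add (hVint t ht.le).1) le_rfl (hVle t ht)
  refine ⟨fun t ht => (hfin t ht).1, ?_⟩
  have hsum : ∑ t ∈ Finset.range T, ∫ ω, |h (x t ω)| ∂μ
      ≤ τ * ∑ t ∈ Finset.range T, ∫ ω, h (x t ω) ^ 2 * a t ω ∂μ + T * (1 / τ * totalBound A) := by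
    calc _ ≤ ∑ t ∈ Finset.range T,
          (τ * ∫ ω, h (x t ω) ^ 2 * a t ω ∂μ + 1 / τ * totalBound A) :=
          Finset.sum_le_sum fun t ht => (hfin t (Finset.mem_range.1 ht)).2
      _ = _ := by
          rw [Finset.sum_add_distrib, ← Finset.mul_sum, Finset.sum_const, Finset.card_range,
            nsmul_eq_mul]
  have hw := p.sum_weighted_le hφ hb hη
  calc θ * ∑ t ∈ Finset.range T, ∫ ω, |h (x t ω)| ∂μ
      ≤ θ * (τ * ∑ t ∈ Finset.range T, ∫ ω, h (x t ω) ^ 2 * a t ω ∂μ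
          + T * (1 / τ * totalBound A)) := by gcongr
    _ = τ * (θ * ∑ t ∈ Finset.range T, ∫ ω, h (x t ω) ^ 2 * a t ω ∂μ)
          + θ * T / τ * totalBound A := by ring
    _ ≤ τ * totalBound A + θ * T / τ * totalBound A := by gcongr
    _ = _ := by ring

end IsRandomPath

/-! ### Separation into coordinates and the gradient of the objective -/

section Gradient

variable {d : ℕ} {Ξ : Type*} {F : Vec d → Ξ → ℝ} {L D₀ D₁ : ℝ}

/-- The point `x` with its `l`-th coordinate replaced by `y`. -/
noncomputable def replaceCoord (x : Vec d) (l : Fin d) (y : ℝ) : Vec d :=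
  x + (y - x l) • EuclideanSpace.single l (1 : ℝ)

lemma replaceCoord_apply_self (x : Vec d) (l : Fin d) (y : ℝ) : replaceCoord x l y l = y := by
  simp [replaceCoord]

lemma replaceCoord_self (x : Vec d) (l : Fin d) : replaceCoord x l (x l) = x := by
  simp [replaceCoord]

/-- The offset `c` is free: `c = 0` serves difference quotients at `x`, and `c = x l` serves
`replaceCoord`. -/
lemma hasDerivAt_comp_line {f : Vec d → ℝ} {v x w : Vec d} {c y : ℝ} {l : Fin d}
    (hf : HasGradientAt f v w) (hw : x + (y - c) • EuclideanSpace.single l (1 : ℝ) = w) :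
    HasDerivAt (fun t : ℝ => f (x + (t - c) • EuclideanSpace.single l (1 : ℝ))) (v l) y := by
  have h1 : HasDerivAt (fun t : ℝ => x + (t - c) • EuclideanSpace.single l (1 : ℝ))
      (EuclideanSpace.single l (1 : ℝ)) y := by
    simpa using (((hasDerivAt_id y).sub_const c).smul_const
      (EuclideanSpace.single l (1 : ℝ))).const_add x
  subst hw
  have h2 := hf.hasFDerivAt.comp_hasDerivAt y h1
  have e : InnerProductSpace.toDual ℝ (Vec d) v (EuclideanSpace.single l (1 : ℝ)) = v l := by
    simp [InnerProductSpace.toDual_apply_apply, EuclideanSpace.inner_single_right]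
  rw [e] at h2
  exact h2

lemma norm_le_sum_abs (v : Vec d) : ‖v‖ ≤ ∑ l, |v l| := by
  have h := (EuclideanSpace.basisFun (Fin d) ℝ).sum_repr v
  calc ‖v‖ = ‖∑ i, v i • EuclideanSpace.basisFun (Fin d) ℝ i‖ := by
        conv_lhs => rw [← h]
        simp
    _ ≤ ∑ i, ‖v i • EuclideanSpace.basisFun (Fin d) ℝ i‖ := norm_sum_le _ _
    _ = _ := by simp [norm_smul]

lemma hasGradientAt_stochGrad (hF : CoordSmooth F L) (x : Vec d) (ξ : Ξ) :
    HasGradientAt (fun y => F y ξ) (stochGrad F x ξ) x :=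
  (hF.1 ξ x).hasGradientAt

/-- The smoothness bound in coordinate `l` vanishes when the `l`-th coordinates agree. This
decouples the whole algorithm. -/
lemma stochGrad_apply_eq (hF : CoordSmooth F L) {x y : Vec d} {l : Fin d} (hxy : x l = y l)
    (ξ : Ξ) : stochGrad F x ξ l = stochGrad F y ξ l := by
  have := hF.2 ξ x y l
  rw [hxy, sub_self, abs_zero, mul_zero] at this
  linarith [abs_nonpos_iff.1 this]

/-- The stochastic partial derivative in direction `l`, as a function of the `l`-th coordinate. -/
noncomputable def partialGrad (F : Vec d → Ξ → ℝ) (x₁ : Vec d) (l : Fin d) (y : ℝ) (ξ : Ξ) : ℝ :=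
  stochGrad F (replaceCoord x₁ l y) ξ l

lemma stochGrad_apply_eq_partialGrad (hF : CoordSmooth F L) (x₁ x : Vec d) (l : Fin d) (ξ : Ξ) :
    stochGrad F x ξ l = partialGrad F x₁ l (x l) ξ :=
  stochGrad_apply_eq hF (replaceCoord_apply_self x₁ l (x l)).symm ξ

variable [MeasurableSpace Ξ] {P : Measure Ξ}

/-- A partial derivative is the limit of difference quotients along `1 / (n + 1)`, each measurable
in the sample. -/
lemma measurable_stochGrad_apply (hF : CoordSmooth F L) (hm : ∀ x, Measurable (F x)) (x : Vec d)
    (l : Fin d) : Measurable fun ξ => stochGrad F x ξ l := by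
  let e := EuclideanSpace.single l (1 : ℝ)
  refine measurable_of_tendsto_metrizable
    (f := fun (n : ℕ) ξ => (n + 1 : ℝ) * (F (x + ((1 / (n + 1 : ℝ)) • e)) ξ - F x ξ))
    (fun n => ((hm _).sub (hm _)).const_mul _) ?_
  rw [tendsto_pi_nhds]
  intro ξ
  have h1 := hasDerivAt_comp_line (c := 0) (y := 0) (l := l) (hasGradientAt_stochGrad hF x ξ)
    (x := x) (by simp)
  have h2 := (hasDerivAt_iff_tendsto_slope_zero.1 h1).comp
    (f := fun n : ℕ => (1 / (n + 1 : ℝ))) (x := Filter.atTop) ?_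
  · refine h2.congr fun n => ?_
    simp [e]
  · refine tendsto_nhdsWithin_iff.2 ⟨tendsto_one_div_add_atTop_nhds_zero_nat, .of_forall fun n => ?_⟩
    have : (0 : ℝ) < 1 / ((n : ℝ) + 1) := by positivity
    exact this.ne'

variable [IsProbabilityMeasure P]

lemma integrable_stochGrad_apply (hF : CoordSmooth F L) (hm : ∀ x, Measurable (F x))
    (hN : CoordAffineNoise F P D₀ D₁) (x : Vec d) (l : Fin d) :
    Integrable (fun ξ => stochGrad F x ξ l) P :=
  ((memLp_two_iff_integrable_sq (measurable_stochGrad_apply hF hm x l).aestronglyMeasurable).2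
    (hN x l).1).integrable (by norm_num)

lemma measurable_stochGrad (hF : CoordSmooth F L) (hm : ∀ x, Measurable (F x)) (x : Vec d) :
    Measurable fun ξ => stochGrad F x ξ := by
  have h := (WithLp.measurable_toLp 2 (Fin d → ℝ)).comp
    (measurable_pi_lambda (fun ξ l => stochGrad F x ξ l)
      fun l => measurable_stochGrad_apply hF hm x l)
  exact h

lemma integrable_stochGrad (hF : CoordSmooth F L) (hm : ∀ x, Measurable (F x))
    (hN : CoordAffineNoise F P D₀ D₁) (x : Vec d) : Integrable (fun ξ => stochGrad F x ξ) P := by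
  refine (integrable_finsetSum Finset.univ fun l _ =>
    (integrable_stochGrad_apply hF hm hN x l).abs).mono'
    (measurable_stochGrad hF hm x).aestronglyMeasurable (.of_forall fun ξ => norm_le_sum_abs _)

/-- The gradient of the objective is the mean of the stochastic gradient. -/
lemma hasGradientAt_objective (hF : CoordSmooth F L) (hm : ∀ x, Measurable (F x))
    (hi : ∀ x, Integrable (F x) P) (hL : 0 ≤ L) (hN : CoordAffineNoise F P D₀ D₁) (x : Vec d) :
    HasGradientAt (objective F P) (∫ ξ, stochGrad F x ξ ∂P) x := by
  let T := (InnerProductSpace.toDual ℝ (Vec d)).toContinuousLinearEquiv.toContinuousLinearMap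
  have hint := integrable_stochGrad hF hm hN x
  -- Differentiation under the integral on the unit ball, where the stochastic gradient moves by at
  -- most `L` in each coordinate.
  have key := hasFDerivAt_integral_of_dominated_of_fderiv_le (𝕜 := ℝ) (μ := P)
    (F := fun y ξ => F y ξ) (F' := fun y ξ => InnerProductSpace.toDual ℝ (Vec d) (stochGrad F y ξ))
    (x₀ := x) (s := Metric.ball x 1) (bound := fun ξ => ∑ l, (|stochGrad F x ξ l| + L))
    (Metric.ball_mem_nhds x one_pos)
    (.of_forall fun y => (hm y).aestronglyMeasurable) (hi x)
    ((InnerProductSpace.toDual ℝ (Vec d)).continuous.comp_aestronglyMeasurable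
      hint.aestronglyMeasurable)
    (.of_forall fun ξ y hy => ?_)
    (integrable_finsetSum _ fun l _ =>
      ((integrable_stochGrad_apply hF hm hN x l).abs.add (integrable_const L)))
    (.of_forall fun ξ y _ => (hasGradientAt_stochGrad hF y ξ).hasFDerivAt)
  · rw [hasGradientAt_iff_hasFDerivAt]
    have e : ∫ ξ, InnerProductSpace.toDual ℝ (Vec d) (stochGrad F x ξ) ∂P
        = InnerProductSpace.toDual ℝ (Vec d) (∫ ξ, stochGrad F x ξ ∂P) := T.integral_comp_comm hint
    rw [← e]
    exact key
  · rw [LinearIsometryEquiv.norm_map]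
    refine (norm_le_sum_abs _).trans (Finset.sum_le_sum fun l _ => ?_)
    have h1 := hF.2 ξ y x l
    have h2 : |y l - x l| ≤ 1 := by
      have h3 := PiLp.norm_apply_le (y - x) l
      rw [Metric.mem_ball, dist_eq_norm] at hy
      simp only [PiLp.sub_apply, Real.norm_eq_abs] at h3
      linarith
    have h4 := mul_le_mul_of_nonneg_left h2 hL
    have h5 := abs_add_le (stochGrad F x ξ l) (stochGrad F y ξ l - stochGrad F x ξ l)
    rw [add_sub_cancel] at h5
    linarith

lemma gradient_objective_apply (hF : CoordSmooth F L) (hm : ∀ x, Measurable (F x))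
    (hi : ∀ x, Integrable (F x) P) (hL : 0 ≤ L) (hN : CoordAffineNoise F P D₀ D₁) (x : Vec d)
    (l : Fin d) : gradient (objective F P) x l = ∫ ξ, stochGrad F x ξ l ∂P := by
  rw [(hasGradientAt_objective hF hm hi hL hN x).gradient]
  exact ((EuclideanSpace.proj (𝕜 := ℝ) l).integral_comp_comm
    (integrable_stochGrad hF hm hN x)).symm

lemma gradient_objective_apply_eq (hF : CoordSmooth F L) (hm : ∀ x, Measurable (F x))
    (hi : ∀ x, Integrable (F x) P) (hL : 0 ≤ L) (hN : CoordAffineNoise F P D₀ D₁) (x₁ x : Vec d)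
    (l : Fin d) :
    gradient (objective F P) x l = gradient (objective F P) (replaceCoord x₁ l (x l)) l := by
  rw [gradient_objective_apply hF hm hi hL hN, gradient_objective_apply hF hm hi hL hN]
  exact integral_congr_ae (.of_forall fun ξ => stochGrad_apply_eq_partialGrad hF x₁ x l ξ)

lemma isSampleGradient_partialGrad (hF : CoordSmooth F L) (hm : ∀ x, Measurable (F x))
    (hi : ∀ x, Integrable (F x) P) (hL : 0 ≤ L) (hN : CoordAffineNoise F P D₀ D₁) (x₁ : Vec d)
    (l : Fin d) {A : ℝ} (hA : L ≤ A) :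
    IsSampleGradient P (partialGrad F x₁ l)
      (fun y => gradient (objective F P) (replaceCoord x₁ l y) l) A D₀ D₁ where
  measurable y := measurable_stochGrad_apply hF hm _ l
  lip ξ x y := by
    have := hF.2 ξ (replaceCoord x₁ l x) (replaceCoord x₁ l y) l
    rw [replaceCoord_apply_self, replaceCoord_apply_self] at this
    exact this.trans (mul_le_mul_of_nonneg_right hA (abs_nonneg _))
  mean y := (gradient_objective_apply hF hm hi hL hN _ l).symm
  integrable_sq y := (hN _ l).1
  integral_sq_le y := (hN _ l).2

lemma hasDerivAt_objective_replaceCoord (hF : CoordSmooth F L) (hm : ∀ x, Measurable (F x))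
    (hi : ∀ x, Integrable (F x) P) (hL : 0 ≤ L) (hN : CoordAffineNoise F P D₀ D₁) (x₁ : Vec d)
    (l : Fin d) (y : ℝ) :
    HasDerivAt (fun y => objective F P (replaceCoord x₁ l y))
      (gradient (objective F P) (replaceCoord x₁ l y) l) y := by
  have h := hasGradientAt_objective hF hm hi hL hN (replaceCoord x₁ l y)
  rw [h.gradient]
  exact hasDerivAt_comp_line h rfl

end Gradient

/-! ### The recursions of one coordinate, measurability and independence of the past -/

section Run

variable {d : ℕ} {Ξ : Type*} {F : Vec d → Ξ → ℝ} {β₁ β₂ η ρ ε : ℝ} {x₁ : Vec d}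

lemma run_congr {z z' : ℕ → Ξ} {t : ℕ} (hz : ∀ k < t, z k = z' k) :
    run F β₁ β₂ η ρ ε x₁ z t = run F β₁ β₂ η ρ ε x₁ z' t := by
  induction t with
  | zero => rfl
  | succ t ih =>
    simp only [run]
    rw [ih fun k hk => hz k (by omega), hz t (by omega)]

/-- The perturbed weights of iteration `t + 1`. -/
noncomputable def perturbed (F : Vec d → Ξ → ℝ) (β₁ β₂ η ρ ε : ℝ) (x₁ : Vec d) (z : ℕ → Ξ) (t : ℕ)
    (l : Fin d) : ℝ :=
  (run F β₁ β₂ η ρ ε x₁ z t).x l + ρ * (1 / √((run F β₁ β₂ η ρ ε x₁ z (t + 1)).u l)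
    * (run F β₁ β₂ η ρ ε x₁ z (t + 1)).r l)

lemma run_r_succ {L : ℝ} (hF : CoordSmooth F L) (z : ℕ → Ξ) (t : ℕ) (l : Fin d) :
    (run F β₁ β₂ η ρ ε x₁ z (t + 1)).r l = β₁ * (run F β₁ β₂ η ρ ε x₁ z t).r l
      + (1 - β₁) * partialGrad F x₁ l ((run F β₁ β₂ η ρ ε x₁ z t).x l) (z t) := by
  rw [← stochGrad_apply_eq_partialGrad hF]
  simp [run, State.step]

lemma run_u_succ {L : ℝ} (hF : CoordSmooth F L) (z : ℕ → Ξ) (t : ℕ) (l : Fin d) :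
    (run F β₁ β₂ η ρ ε x₁ z (t + 1)).u l = β₂ * (run F β₁ β₂ η ρ ε x₁ z t).u l
      + (1 - β₂) * partialGrad F x₁ l ((run F β₁ β₂ η ρ ε x₁ z t).x l) (z t) ^ 2 := by
  rw [← stochGrad_apply_eq_partialGrad hF]
  simp [run, State.step, sq]

lemma run_m_succ {L : ℝ} (hF : CoordSmooth F L) (z : ℕ → Ξ) (t : ℕ) (l : Fin d) :
    (run F β₁ β₂ η ρ ε x₁ z (t + 1)).m l = β₁ * (run F β₁ β₂ η ρ ε x₁ z t).m l
      + (1 - β₁) * partialGrad F x₁ l (perturbed F β₁ β₂ η ρ ε x₁ z t l) (z t) := by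
  have := stochGrad_apply_eq_partialGrad hF x₁
    (WithLp.toLp 2 fun l => perturbed F β₁ β₂ η ρ ε x₁ z t l) l (z t)
  simp only at this
  rw [← this]
  simp [run, State.step, perturbed]

lemma run_v_succ {L : ℝ} (hF : CoordSmooth F L) (z : ℕ → Ξ) (t : ℕ) (l : Fin d) :
    (run F β₁ β₂ η ρ ε x₁ z (t + 1)).v l = β₂ * (run F β₁ β₂ η ρ ε x₁ z t).v l
      + (1 - β₂) * partialGrad F x₁ l (perturbed F β₁ β₂ η ρ ε x₁ z t l) (z t) ^ 2 := by
  have := stochGrad_apply_eq_partialGrad hF x₁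
    (WithLp.toLp 2 fun l => perturbed F β₁ β₂ η ρ ε x₁ z t l) l (z t)
  simp only at this
  rw [← this]
  simp [run, State.step, perturbed, sq]

lemma run_x_succ (z : ℕ → Ξ) (t : ℕ) (l : Fin d) :
    (run F β₁ β₂ η ρ ε x₁ z (t + 1)).x l = (run F β₁ β₂ η ρ ε x₁ z t).x l
      - η * (1 / √((run F β₁ β₂ η ρ ε x₁ z (t + 1)).v l)
        * (run F β₁ β₂ η ρ ε x₁ z (t + 1)).m l) := by
  simp [run, State.step]

variable [MeasurableSpace Ξ]

/-- The induction stays within one coordinate, since no update of coordinate `l` involves another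
one. -/
lemma measurable_run {L : ℝ} (hF : CoordSmooth F L) (l : Fin d)
    (hG : Measurable (Function.uncurry (partialGrad F x₁ l))) (t : ℕ) :
    (Measurable fun z => (run F β₁ β₂ η ρ ε x₁ z t).x l) ∧
    (Measurable fun z => (run F β₁ β₂ η ρ ε x₁ z t).r l) ∧
    (Measurable fun z => (run F β₁ β₂ η ρ ε x₁ z t).u l) ∧
    (Measurable fun z => (run F β₁ β₂ η ρ ε x₁ z t).m l) ∧
    (Measurable fun z => (run F β₁ β₂ η ρ ε x₁ z t).v l) := by
  induction t with
  | zero => simp [run]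
  | succ t ih =>
    obtain ⟨hx, hr, hu, hm, hv⟩ := ih
    have hcomp : ∀ X : (ℕ → Ξ) → ℝ, Measurable X →
        Measurable fun z => partialGrad F x₁ l (X z) (z t) := fun X hX =>
      hG.comp (hX.prodMk (measurable_pi_apply t))
    have hs := hcomp _ hx
    have hr' : Measurable fun z => (run F β₁ β₂ η ρ ε x₁ z (t + 1)).r l := by
      simp only [run_r_succ hF]
      exact (hr.const_mul _).add (hs.const_mul _)
    have hu' : Measurable fun z => (run F β₁ β₂ η ρ ε x₁ z (t + 1)).u l := by
      simp only [run_u_succ hF]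
      exact (hu.const_mul _).add ((hs.pow_const 2).const_mul _)
    have hw : Measurable fun z => perturbed F β₁ β₂ η ρ ε x₁ z t l :=
      hx.add (((hu'.sqrt.const_div 1).mul hr').const_mul ρ)
    have hg := hcomp _ hw
    have hm' : Measurable fun z => (run F β₁ β₂ η ρ ε x₁ z (t + 1)).m l := by
      simp only [run_m_succ hF]
      exact (hm.const_mul _).add (hg.const_mul _)
    have hv' : Measurable fun z => (run F β₁ β₂ η ρ ε x₁ z (t + 1)).v l := by
      simp only [run_v_succ hF]
      exact (hv.const_mul _).add ((hg.pow_const 2).const_mul _)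
    refine ⟨?_, hr', hu', hm', hv'⟩
    simp only [run_x_succ]
    exact hx.sub (((hv'.sqrt.const_div 1).mul hm').const_mul η)

end Run

/-- A function of the first `t` samples is independent of the `t`-th one. -/
lemma indepFun_of_depends_on_past {Ω Ξ E : Type*} [MeasurableSpace Ω] [MeasurableSpace Ξ]
    [MeasurableSpace E] [Nonempty Ξ] {μ : Measure Ω} {ξ : ℕ → Ω → Ξ} (hξ : ∀ t, Measurable (ξ t))
    (hind : iIndepFun ξ μ) {t : ℕ} {Ψ : (ℕ → Ξ) → E} (hΨ : Measurable Ψ)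
    (hpast : ∀ z z' : ℕ → Ξ, (∀ k < t, z k = z' k) → Ψ z = Ψ z') :
    IndepFun (fun ω => Ψ fun k => ξ k ω) (ξ t) μ := by
  classical
  obtain ⟨ξ₀⟩ := ‹Nonempty Ξ›
  have h := hind.indepFun_finset (Finset.range t) {t} (by simp) hξ
  -- A sequence is rebuilt from its first `t` samples by filling in an arbitrary `ξ₀`; `Ψ` does not
  -- see the filling.
  let ext : (Finset.range t → Ξ) → ℕ → Ξ := fun y k =>
    if hk : k ∈ Finset.range t then y ⟨k, hk⟩ else ξ₀
  have hext : Measurable ext := measurable_pi_lambda _ fun k => by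
    by_cases hk : k ∈ Finset.range t
    · simpa only [ext, hk, dif_pos] using measurable_pi_apply (⟨k, hk⟩ : Finset.range t)
    · simpa only [ext, hk, dif_neg, not_false_eq_true] using measurable_const
  have h' := h.comp (hΨ.comp hext)
    (measurable_pi_apply (⟨t, Finset.mem_singleton_self t⟩ : ({t} : Finset ℕ)))
  convert h' using 1
  · funext ω
    refine hpast _ _ fun k hk => ?_
    simp [ext, hk]
  · rfl

/-! ### Consequences of the conditions on `β₂` -/

/-- The lower bound on `β₂` is the positive root of `y ^ 2 + D * y - D`, so it says `D * (1 - β₂) ≤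
β₂ ^ 2`. The first two entries of the maximum defining `D₃` give the two conclusions. -/
lemma beta_bounds_of_D₃ {β₁ β₂ η ρ L ε D₁ a b : ℝ} (hβ₁ : 0 ≤ β₁)
    (h₁ : β₁ < √β₂) (h₂ : √β₂ < 1)
    (h : (√(D₃ β₁ β₂ η ρ L ε D₁ a b ^ 2 + 4 * D₃ β₁ β₂ η ρ L ε D₁ a b)
            - D₃ β₁ β₂ η ρ L ε D₁ a b) / 2 ≤ β₂) :
    3 / 4 ≤ β₂ ∧ 256 * D₁ * (1 - β₂) ≤ β₂ - β₁ ^ 2 := by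
  have hq : 0 < √β₂ := hβ₁.trans_lt h₁
  have hβ : 0 < β₂ := Real.sqrt_pos.1 hq
  have hsq : √β₂ ^ 2 = β₂ := Real.sq_sqrt hβ.le
  have hD4 : 4 * √β₂ ≤ D₃ β₁ β₂ η ρ L ε D₁ a b := le_max_left _ _
  have hD256 : 256 * √β₂ * D₁ / (β₂ - β₁ ^ 2) ≤ D₃ β₁ β₂ η ρ L ε D₁ a b :=
    (le_max_left _ _).trans (le_max_right _ _)
  generalize D₃ β₁ β₂ η ρ L ε D₁ a b = D at *
  generalize √β₂ = q at *
  subst hsq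
  have hD0 : 0 ≤ D := by linarith
  have hgap : 0 < q ^ 2 - β₁ ^ 2 := by nlinarith
  have hmain : D * (1 - q ^ 2) ≤ (q ^ 2) ^ 2 := by
    have h3 : √(D ^ 2 + 4 * D) ≤ D + 2 * q ^ 2 := by linarith
    have h4 := (Real.sqrt_le_left (by positivity)).1 h3
    nlinarith
  have hα : 0 < 1 - q ^ 2 := by nlinarith
  have hq3 : q ^ 3 ≤ 1 := pow_le_one₀ hq.le h₂.le
  constructor
  · have h3 : 4 * q * (1 - q ^ 2) ≤ (q ^ 2) ^ 2 :=
      (mul_le_mul_of_nonneg_right hD4 hα.le).trans hmain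
    have h4 : 4 * (1 - q ^ 2) ≤ q ^ 3 := by
      by_contra hc
      nlinarith [mul_lt_mul_of_pos_left (not_le.1 hc) hq]
    linarith
  · have h3 := (mul_le_mul_of_nonneg_right hD256 hα.le).trans hmain
    rw [div_mul_eq_mul_div, div_le_iff₀ hgap] at h3
    have h4 : 256 * D₁ * (1 - q ^ 2) ≤ q ^ 3 * (q ^ 2 - β₁ ^ 2) := by
      by_contra hc
      nlinarith [mul_lt_mul_of_pos_left (not_le.1 hc) hq]
    exact h4.trans (mul_le_of_le_one_left hgap.le hq3)

/-- Keeps `1 - γ` away from 0 uniformly in `β₂`: the hypothesis makes `1 - q ^ 2` at most a multiple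
of `q ^ 2 - β₁ ^ 2`, so the latter dominates a multiple of their sum `1 - β₁ ^ 2`. -/
lemma one_le_mul_momentum_gap {β₁ q D₁ A : ℝ} (hβ₁ : 0 ≤ β₁) (hD₁ : 0 < D₁) (h₁ : β₁ < q)
    (h₂ : q < 1) (h : 256 * D₁ * (1 - q ^ 2) ≤ q ^ 2 - β₁ ^ 2)
    (hA : 2 * (1 + 1 / (256 * D₁)) / (1 - β₁ ^ 2) ≤ A) : 1 ≤ A * (1 - β₁ / q) := by
  have hq : 0 < q := hβ₁.trans_lt h₁
  have h3 : 0 < 1 - β₁ ^ 2 := by nlinarith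
  have h4 : 1 - β₁ ^ 2 ≤ (1 + 1 / (256 * D₁)) * (q ^ 2 - β₁ ^ 2) := by
    have : 1 - q ^ 2 ≤ 1 / (256 * D₁) * (q ^ 2 - β₁ ^ 2) := by
      rw [div_mul_eq_mul_div, le_div_iff₀ (by positivity)]
      linarith
    linarith
  have h5 : q ^ 2 - β₁ ^ 2 ≤ 2 * (1 - β₁ / q) := by
    have e : (1 - β₁ / q) * q = q - β₁ := by field_simp
    have : 0 ≤ 1 - β₁ / q := by
      rw [sub_nonneg, div_le_one hq]; exact h₁.le
    nlinarith
  have h6 : 0 ≤ 1 - β₁ / q := by rw [sub_nonneg, div_le_one hq]; exact h₁.le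
  have hc : 0 < 1 + 1 / (256 * D₁) := by positivity
  calc (1 : ℝ) = 1 / (1 - β₁ ^ 2) * (1 - β₁ ^ 2) := by field_simp
    _ ≤ 1 / (1 - β₁ ^ 2) * ((1 + 1 / (256 * D₁)) * (2 * (1 - β₁ / q))) := by
        gcongr
        exact h4.trans (by gcongr)
    _ = 2 * (1 + 1 / (256 * D₁)) / (1 - β₁ ^ 2) * (1 - β₁ / q) := by ring
    _ ≤ _ := by gcongr

/-- The rescaling factors are at most `β₂ ^ (-T) ≤ exp (T * (1 - β₂) / β₂)`; the exponent is bounded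
by `1 - β₂ ≤ Cβ / T` and `β₂ ≥ 3 / 4`. -/
lemma one_div_sqrt_pow_le {β₂ Cβ A : ℝ} {T t : ℕ} (hβ : 3 / 4 ≤ β₂) (hβ1 : β₂ < 1) (hT : 0 < T)
    (hα : 1 - β₂ ≤ Cβ / T) (hA : Real.exp (4 / 3 * |Cβ|) ≤ A) (ht : t ≤ T) :
    1 / √β₂ ^ t ≤ A := by
  have hβ0 : 0 < β₂ := by linarith
  have hq : β₂ ≤ √β₂ := Real.le_sqrt_of_sq_le (by nlinarith)
  have hT' : (0 : ℝ) < T := by exact_mod_cast hT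
  calc 1 / √β₂ ^ t ≤ 1 / β₂ ^ t := by gcongr
    _ ≤ 1 / β₂ ^ T := by
        gcongr 1 / ?_
        exact pow_le_pow_of_le_one hβ0.le hβ1.le ht
    _ = (1 + (1 - β₂) / β₂) ^ T := by
        rw [← one_div_pow]
        congr 1
        field_simp
        ring
    _ ≤ Real.exp ((1 - β₂) / β₂) ^ T := by
        have : 0 ≤ (1 - β₂) / β₂ := div_nonneg (by linarith) hβ0.le
        gcongr
        linarith [Real.add_one_le_exp ((1 - β₂) / β₂)]
    _ = Real.exp (T * ((1 - β₂) / β₂)) := by rw [← Real.exp_nat_mul]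
    _ ≤ Real.exp (4 / 3 * |Cβ|) := by
        apply Real.exp_le_exp.2
        rw [le_div_iff₀ hT'] at hα
        rw [← mul_div_assoc, div_le_iff₀ hβ0]
        have := le_abs_self Cβ
        have := abs_nonneg Cβ
        nlinarith
    _ ≤ A := hA

/-! ### Rescaling: each coordinate is a random path -/

section Coordinate

variable {d : ℕ} {Ξ : Type*} {F : Vec d → Ξ → ℝ} {β₁ β₂ η ρ ε : ℝ} {x₁ : Vec d}

lemma sq_mul_pow_le_run_u {L : ℝ} (hF : CoordSmooth F L) (hβ : 0 < β₂) (hβ1 : β₂ ≤ 1) (z : ℕ → Ξ)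
    (l : Fin d) (t : ℕ) : ε ^ 2 * β₂ ^ t ≤ (run F β₁ β₂ η ρ ε x₁ z t).u l := by
  induction t with
  | zero => simp [run, State.init]
  | succ t ih =>
    rw [run_u_succ hF]
    have := mul_nonneg (sub_nonneg.2 hβ1)
      (sq_nonneg (partialGrad F x₁ l ((run F β₁ β₂ η ρ ε x₁ z t).x l) (z t)))
    have := mul_le_mul_of_nonneg_left ih hβ.le
    rw [pow_succ β₂]
    linarith

/-- The rescaled second moment of the update step. -/
noncomputable def rescaledV (F : Vec d → Ξ → ℝ) (β₁ β₂ η ρ ε : ℝ) (x₁ : Vec d) (l : Fin d)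
    (z : ℕ → Ξ) (t : ℕ) : ℝ :=
  (run F β₁ β₂ η ρ ε x₁ z t).v l / β₂ ^ t

/-- The rescaled perturbed gradient. -/
noncomputable def rescaledG (F : Vec d → Ξ → ℝ) (β₁ β₂ η ρ ε : ℝ) (x₁ : Vec d) (l : Fin d)
    (z : ℕ → Ξ) (t : ℕ) : ℝ :=
  partialGrad F x₁ l (perturbed F β₁ β₂ η ρ ε x₁ z t l) (z t) / √β₂ ^ (t + 1)

lemma rescaledV_zero (z : ℕ → Ξ) (l : Fin d) : rescaledV F β₁ β₂ η ρ ε x₁ l z 0 = ε ^ 2 := by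
  simp [rescaledV, run, State.init]

/-- Division by `β₂ ^ (t + 1)` cancels the decay: the moving average becomes an AdaGrad sum. -/
lemma rescaledV_succ {L : ℝ} (hF : CoordSmooth F L) (hβ : 0 < β₂) (z : ℕ → Ξ) (l : Fin d) (t : ℕ) :
    rescaledV F β₁ β₂ η ρ ε x₁ l z (t + 1) = rescaledV F β₁ β₂ η ρ ε x₁ l z t
      + (1 - β₂) * rescaledG F β₁ β₂ η ρ ε x₁ l z t ^ 2 := by
  unfold rescaledV rescaledG
  rw [run_v_succ hF, div_pow, ← pow_mul, mul_comm (t + 1) 2, pow_mul, Real.sq_sqrt hβ.le]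
  field_simp
  ring

lemma monotone_rescaledV {L : ℝ} (hF : CoordSmooth F L) (hβ : 0 < β₂) (hβ1 : β₂ ≤ 1) (z : ℕ → Ξ)
    (l : Fin d) : Monotone (rescaledV F β₁ β₂ η ρ ε x₁ l z) := by
  refine monotone_nat_of_le_succ fun t => ?_
  rw [rescaledV_succ hF hβ]
  have := mul_nonneg (sub_nonneg.2 hβ1) (sq_nonneg (rescaledG F β₁ β₂ η ρ ε x₁ l z t))
  linarith

lemma sq_le_rescaledV {L : ℝ} (hF : CoordSmooth F L) (hβ : 0 < β₂) (hβ1 : β₂ ≤ 1) (z : ℕ → Ξ)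
    (l : Fin d) (t : ℕ) : ε ^ 2 ≤ rescaledV F β₁ β₂ η ρ ε x₁ l z t := by
  rw [← rescaledV_zero (F := F) (β₁ := β₁) (β₂ := β₂) (η := η) (ρ := ρ) (x₁ := x₁) z l]
  exact monotone_rescaledV hF hβ hβ1 z l t.zero_le

lemma run_x_succ_eq_rescaled (hβ : 0 < β₂) (z : ℕ → Ξ) (t : ℕ) (l : Fin d) :
    (run F β₁ β₂ η ρ ε x₁ z (t + 1)).x l = (run F β₁ β₂ η ρ ε x₁ z t).x l
      - η * ((run F β₁ β₂ η ρ ε x₁ z (t + 1)).m l / √β₂ ^ (t + 1)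
        * (1 / √(rescaledV F β₁ β₂ η ρ ε x₁ l z (t + 1)))) := by
  have e : √(rescaledV F β₁ β₂ η ρ ε x₁ l z (t + 1))
      = √((run F β₁ β₂ η ρ ε x₁ z (t + 1)).v l) / √β₂ ^ (t + 1) := by
    unfold rescaledV
    rw [Real.sqrt_div' _ (by positivity)]
    congr 1
    rw [Real.sqrt_eq_iff_mul_self_eq (by positivity) (by positivity), ← mul_pow,
      Real.mul_self_sqrt hβ.le]
  have hq : √β₂ ^ (t + 1) ≠ 0 := (pow_pos (Real.sqrt_pos.2 hβ) _).ne'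
  rw [run_x_succ, e, one_div_div]
  congr 2
  field_simp

/-- The five factors `A` are the rescaling, `L`, `ρ / θ`, and two for `1 / √u`, since `√u ≥ ε * √β₂
^ (t + 1)`. -/
lemma abs_rescaledG_sub_le {L A θ : ℝ} (hF : CoordSmooth F L) (hL : 0 ≤ L) (hβ : 0 < β₂)
    (hβ1 : β₂ ≤ 1) (hε : 0 < ε) (hεA : 1 / ε ≤ A) (hLA : L ≤ A) (hθ : 0 ≤ θ) (hρ : 0 ≤ ρ)
    (hρA : ρ ≤ A * θ) (z : ℕ → Ξ) (t : ℕ) (l : Fin d) (hb : 1 / √β₂ ^ (t + 1) ≤ A) :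
    |rescaledG F β₁ β₂ η ρ ε x₁ l z t
        - 1 / √β₂ ^ (t + 1) * partialGrad F x₁ l ((run F β₁ β₂ η ρ ε x₁ z t).x l) (z t)|
      ≤ A ^ 5 * θ * |(run F β₁ β₂ η ρ ε x₁ z (t + 1)).r l| := by
  have hA : 0 ≤ A := hL.trans hLA
  have hq : 0 < √β₂ ^ (t + 1) := pow_pos (Real.sqrt_pos.2 hβ) _
  have hu : ε * √β₂ ^ (t + 1) ≤ √((run F β₁ β₂ η ρ ε x₁ z (t + 1)).u l) := by
    apply Real.le_sqrt_of_sq_le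
    rw [mul_pow, ← pow_mul, mul_comm (t + 1) 2, pow_mul, Real.sq_sqrt hβ.le]
    exact sq_mul_pow_le_run_u hF hβ hβ1 z l (t + 1)
  have hu' : 1 / √((run F β₁ β₂ η ρ ε x₁ z (t + 1)).u l) ≤ A * A := by
    calc 1 / √((run F β₁ β₂ η ρ ε x₁ z (t + 1)).u l) ≤ 1 / (ε * √β₂ ^ (t + 1)) := by gcongr
      _ = 1 / ε * (1 / √β₂ ^ (t + 1)) := by field_simp
      _ ≤ _ := by gcongr
  have hG := hF.2 (z t) (replaceCoord x₁ l (perturbed F β₁ β₂ η ρ ε x₁ z t l))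
    (replaceCoord x₁ l ((run F β₁ β₂ η ρ ε x₁ z t).x l)) l
  rw [replaceCoord_apply_self, replaceCoord_apply_self] at hG
  have e1 : perturbed F β₁ β₂ η ρ ε x₁ z t l - (run F β₁ β₂ η ρ ε x₁ z t).x l
      = ρ * (1 / √((run F β₁ β₂ η ρ ε x₁ z (t + 1)).u l)
        * (run F β₁ β₂ η ρ ε x₁ z (t + 1)).r l) := by
    unfold perturbed; ring
  have e2 : rescaledG F β₁ β₂ η ρ ε x₁ l z t
        - 1 / √β₂ ^ (t + 1) * partialGrad F x₁ l ((run F β₁ β₂ η ρ ε x₁ z t).x l) (z t)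
      = 1 / √β₂ ^ (t + 1) * (partialGrad F x₁ l (perturbed F β₁ β₂ η ρ ε x₁ z t l) (z t)
        - partialGrad F x₁ l ((run F β₁ β₂ η ρ ε x₁ z t).x l) (z t)) := by
    unfold rescaledG; ring
  rw [e1, abs_mul, abs_mul, abs_of_nonneg hρ, abs_of_nonneg (by positivity : 0 ≤
    1 / √((run F β₁ β₂ η ρ ε x₁ z (t + 1)).u l))] at hG
  rw [e2, abs_mul, abs_of_nonneg (by positivity : 0 ≤ 1 / √β₂ ^ (t + 1))]
  generalize (run F β₁ β₂ η ρ ε x₁ z (t + 1)).r l = R at *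
  calc _ ≤ A * (L * (ρ * (1 / √((run F β₁ β₂ η ρ ε x₁ z (t + 1)).u l) * |R|))) := by
        gcongr
        exact hG
    _ ≤ A * (A * (A * θ * (A * A * |R|))) := by gcongr
    _ = _ := by ring

variable [MeasurableSpace Ξ] {P : Measure Ξ} [IsProbabilityMeasure P]
  {Ω : Type*} [MeasurableSpace Ω] {μ : Measure Ω} [IsProbabilityMeasure μ]

/-- Each coordinate of the algorithm is a random path of the scalar problem. -/
lemma isRandomPath_run {L D₀ D₁ A θ : ℝ} {T : ℕ} {ξ : ℕ → Ω → Ξ} (l : Fin d)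
    (hm : ∀ x, Measurable (F x)) (hi : ∀ x, Integrable (F x) P) (hF : CoordSmooth F L)
    (hN : CoordAffineNoise F P D₀ D₁) (hξ : ∀ t, Measurable (ξ t)) (hlaw : ∀ t, μ.map (ξ t) = P)
    (hind : iIndepFun ξ μ) (hL : 0 ≤ L) (hD₀ : 0 < D₀) (hD₁ : 0 < D₁) (hε : 0 < ε)
    (hβ₁ : 0 ≤ β₁) (hβ₂ : β₂ ≤ 1) (hββ : β₁ < √β₂) (hη : 0 ≤ η) (hρ : 0 ≤ ρ)
    (hA : 1 ≤ A) (hLA : L ≤ A) (hD₀A : D₀ ≤ A) (hD₁A : D₁ ≤ A) (hεA : 1 / ε ≤ A)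
    (hγA : 1 ≤ A * (1 - β₁ / √β₂)) (hbA : ∀ t ≤ T, 1 / √β₂ ^ t ≤ A)
    (hθ : 0 ≤ θ) (hθ1 : θ ≤ 1) (hθT : θ ^ 2 * T ≤ 1) (hηA : η ≤ A * θ) (hρA : ρ ≤ A * θ) :
    IsRandomPath μ P (partialGrad F x₁ l) ξ A θ η (β₁ / √β₂) β₁ D₀ D₁ T
      (fun y => gradient (objective F P) (replaceCoord x₁ l y) l)
      (fun t => 1 / √β₂ ^ (t + 1))
      (fun t ω => (run F β₁ β₂ η ρ ε x₁ (fun k => ξ k ω) t).x l)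
      (fun t ω => (run F β₁ β₂ η ρ ε x₁ (fun k => ξ k ω) t).r l)
      (fun t ω => rescaledG F β₁ β₂ η ρ ε x₁ l (fun k => ξ k ω) t)
      (fun t ω => (run F β₁ β₂ η ρ ε x₁ (fun k => ξ k ω) t).m l / √β₂ ^ t)
      (fun t ω => 1 / √(rescaledV F β₁ β₂ η ρ ε x₁ l (fun k => ξ k ω) t)) := by
  have hq : 0 < √β₂ := hβ₁.trans_lt hββ
  have hβ : 0 < β₂ := Real.sqrt_pos.1 hq
  have hq1 : √β₂ ≤ 1 := Real.sqrt_le_one.2 hβ₂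
  have hG := isSampleGradient_partialGrad (P := P) hF hm hi hL hN x₁ l hLA
  have hrun := measurable_run (β₁ := β₁) (β₂ := β₂) (η := η) (ρ := ρ) (ε := ε) hF l
    hG.measurable_uncurry
  have hξm : Measurable fun ω k => ξ k ω := measurable_pi_lambda _ hξ
  have hVm : ∀ t, Measurable fun z => rescaledV F β₁ β₂ η ρ ε x₁ l z t := fun t =>
    (hrun t).2.2.2.2.div_const _
  have hVpos : ∀ z t, 0 < rescaledV F β₁ β₂ η ρ ε x₁ l z t := fun z t =>
    lt_of_lt_of_le (by positivity) (sq_le_rescaledV hF hβ hβ₂ z l t)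
  have hpert : ∀ t, Measurable fun z => perturbed F β₁ β₂ η ρ ε x₁ z t l := fun t =>
    (hrun t).1.add ((((hrun (t + 1)).2.2.1.sqrt.const_div 1).mul (hrun (t + 1)).2.1).const_mul ρ)
  have hgm : ∀ t, Measurable fun z => rescaledG F β₁ β₂ η ρ ε x₁ l z t := fun t => by
    have hcomp : ∀ X : (ℕ → Ξ) → ℝ, Measurable X →
        Measurable fun z => partialGrad F x₁ l (X z) (z t) := fun X hX =>
      hG.measurable_uncurry.comp (hX.prodMk (measurable_pi_apply t))
    exact (hcomp _ (hpert t)).div_const _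
  have ham : ∀ t, Measurable fun z => 1 / √(rescaledV F β₁ β₂ η ρ ε x₁ l z t) := fun t =>
    (hVm t).sqrt.const_div 1
  have : Nonempty Ξ := P.nonempty_of_neZero
  exact
    { grad := hG
      path := fun ω =>
        { one_le_A := hA
          θ_nonneg := hθ
          θ_le := hθ1
          η_nonneg := hη
          η_le := hηA
          β_nonneg := hβ₁
          β_le := (le_div_iff₀ hq).2 (mul_le_of_le_one_right hβ₁ hq1)
          gap := hγA
          D₀_pos := hD₀
          D₀_le := hD₀A
          D₁_nonneg := hD₁.le
          D₁_le := hD₁A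
          lip := hG.mean_lip
          one_le_b := fun t _ => (one_le_div (pow_pos hq _)).2 (pow_le_one₀ hq.le hq1)
          b_le := fun t ht => hbA (t + 1) ht
          m_zero := by simp [run, State.init]
          m_succ := fun t => by
            simp only [run_m_succ hF, rescaledG]
            field_simp
            ring
          x_succ := fun t => run_x_succ_eq_rescaled hβ _ t l
          a_nonneg := fun t => by positivity
          a_le := fun t => by
            refine le_trans ?_ hεA
            gcongr
            exact Real.le_sqrt_of_sq_le (sq_le_rescaledV hF hβ hβ₂ _ l t)
          a_anti := fun t => by
            have := Real.sqrt_pos.2 (hVpos (fun k => ξ k ω) t)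
            have := monotone_rescaledV (β₁ := β₁) (η := η) (ρ := ρ) (ε := ε) (x₁ := x₁) hF hβ hβ₂
              (fun k => ξ k ω) l t.le_succ
            gcongr
          g_sub := fun t ht => abs_rescaledG_sub_le hF hL hβ hβ₂ hε hεA hLA hθ hρ hρA _ t l
            (hbA (t + 1) ht) }
      D₁_pos := hD₁
      θ_sq_mul_le := hθT
      measurable_ξ := hξ
      law := hlaw
      measurable_x := fun t => (hrun t).1.comp hξm
      measurable_g := fun t => (hgm t).comp hξm
      measurable_a := fun t => (ham t).comp hξm
      -- The iterate and the stepsize of index `t` are functions of the samples of index below `t`.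
      indep := fun t => indepFun_of_depends_on_past hξ hind ((hrun t).1.prodMk (ham t))
        fun z z' hz => by
          simp only [rescaledV]
          rw [run_congr hz]
      x_zero := fun _ _ => rfl
      r_zero := fun _ => by simp [run, State.init]
      r_succ := fun t ω => run_r_succ hF _ t l }

/-- The expected partial derivatives along the algorithm. -/
lemma sum_expected_partial_le {L D₀ D₁ A θ : ℝ} {T : ℕ} {ξ : ℕ → Ω → Ξ} (l : Fin d)
    (hm : ∀ x, Measurable (F x)) (hi : ∀ x, Integrable (F x) P) (hF : CoordSmooth F L)
    (hN : CoordAffineNoise F P D₀ D₁) (hΔ : ∀ x, objective F P x₁ - objective F P x ≤ A)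
    (hξ : ∀ t, Measurable (ξ t)) (hlaw : ∀ t, μ.map (ξ t) = P)
    (hind : iIndepFun ξ μ) (hL : 0 ≤ L) (hD₀ : 0 < D₀) (hD₁ : 0 < D₁) (hε : 0 < ε)
    (hβ₁ : 0 ≤ β₁) (hβ₂ : β₂ ≤ 1) (hββ : β₁ < √β₂) (hη : 0 ≤ η) (hρ : 0 ≤ ρ)
    (hA : 1 ≤ A) (hLA : L ≤ A) (hD₀A : D₀ ≤ A) (hD₁A : D₁ ≤ A) (hεA : 1 / ε ≤ A)
    (hεA' : ε ^ 2 ≤ A) (hγA : 1 ≤ A * (1 - β₁ / √β₂)) (hbA : ∀ t ≤ T, 1 / √β₂ ^ t ≤ A)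
    (hθ : 0 ≤ θ) (hθ1 : θ ≤ 1) (hθT : θ ^ 2 * T ≤ 1) (hηA : η ≤ A * θ) (hρA : ρ ≤ A * θ)
    (hθη : θ ≤ A * η) (hα : 1 - β₂ ≤ A * θ ^ 2) {τ : ℝ} (hτ : 0 < τ) :
    (∀ t < T, Integrable (fun ω => |gradient (objective F P)
        (weights F β₁ β₂ η ρ ε x₁ (fun k => ξ k ω) t) l|) μ) ∧
      θ * ∑ t ∈ Finset.range T, ∫ ω, |gradient (objective F P)
          (weights F β₁ β₂ η ρ ε x₁ (fun k => ξ k ω) t) l| ∂μ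
        ≤ IsRandomPath.totalBound A * (τ + θ * T / τ) := by
  have hβ : 0 < β₂ := Real.sqrt_pos.1 (hβ₁.trans_lt hββ)
  have p := isRandomPath_run (x₁ := x₁) (P := P) (μ := μ) l hm hi hF hN hξ hlaw hind hL hD₀ hD₁ hε
    hβ₁ hβ₂ hββ hη hρ hA hLA hD₀A hD₁A hεA hγA hbA hθ hθ1 hθT hηA hρA
  have hrun := measurable_run (β₁ := β₁) (β₂ := β₂) (η := η) (ρ := ρ) (ε := ε) hF l
    p.grad.measurable_uncurry
  have hξm : Measurable fun ω k => ξ k ω := measurable_pi_lambda _ hξ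
  have hV := fun (t : ℕ) (ω : Ω) => sq_le_rescaledV (β₁ := β₁) (η := η) (ρ := ρ) (ε := ε)
    (x₁ := x₁) hF hβ hβ₂ (fun k => ξ k ω) l t
  have hVpos : ∀ t ω, 0 < rescaledV F β₁ β₂ η ρ ε x₁ l (fun k => ξ k ω) t := fun t ω =>
    lt_of_lt_of_le (by positivity) (hV t ω)
  have key := p.sum_expected_gradient_le
    (hasDerivAt_objective_replaceCoord hF hm hi hL hN x₁ l)
    (fun ω y => by
      have e : (run F β₁ β₂ η ρ ε x₁ (fun k => ξ k ω) 0).x l = x₁ l := rfl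
      simp only [e, replaceCoord_self]
      exact hΔ _)
    hθη (α := 1 - β₂) (V := fun t ω => rescaledV F β₁ β₂ η ρ ε x₁ l (fun k => ξ k ω) t)
    (by linarith) hα (fun ω => by rw [rescaledV_zero]; exact hεA')
    (fun t => ((hrun t).2.2.2.2.div_const _).comp hξm)
    (fun t ω => (hVpos t ω).le)
    (fun t ω => rescaledV_succ hF hβ _ l t)
    -- With `a = 1 / √V` the claim reads `√V ≤ 1 + V`.
    (fun t ω => by
      have h1 := hVpos t ω
      generalize rescaledV F β₁ β₂ η ρ ε x₁ l (fun k => ξ k ω) t = V at *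
      have h2 := Real.sqrt_pos.2 h1
      rw [div_mul_eq_mul_div, one_mul, le_div_iff₀ h2]
      nlinarith [Real.sq_sqrt h1.le, sq_nonneg (√V - 1)])
    hτ
  have e : ∀ t ω, gradient (objective F P) (weights F β₁ β₂ η ρ ε x₁ (fun k => ξ k ω) t) l
      = gradient (objective F P)
        (replaceCoord x₁ l ((run F β₁ β₂ η ρ ε x₁ (fun k => ξ k ω) t).x l)) l := fun t ω =>
    gradient_objective_apply_eq hF hm hi hL hN x₁ _ l
  simp only [e]
  exact key

end Coordinate

end LightSAM

/-! ### Assembling the coordinates -/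

theorem theorem3 (d : ℕ) (L D₀ D₁ ε β₁ Δ Cβ cη Cη Cρ : ℝ)
    (hL : 0 ≤ L) (hD₀ : 0 < D₀) (hD₁ : 0 < D₁) (hε : 0 < ε) (hβ₁ : 0 ≤ β₁) (hcη : 0 < cη) :
    ∃ K : ℝ,
      ∀ (Ω : Type*) [MeasurableSpace Ω] (μ : Measure Ω) [IsProbabilityMeasure μ]
        (Ξ : Type*) [MeasurableSpace Ξ] (P : Measure Ξ) [IsProbabilityMeasure P]
        (F : Vec d → Ξ → ℝ) (x₁ : Vec d) (ξ : ℕ → Ω → Ξ)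
        (T : ℕ) (β₂ η ρ a b : ℝ),
        -- the problem: sample losses, objective bounded below with `f(x₁) - inf f ≤ Δ`
        (∀ x, Measurable (F x)) → (∀ x, Integrable (F x) P) →
        (∀ x, objective F P x₁ - objective F P x ≤ Δ) →
        CoordSmooth F L → CoordAffineNoise F P D₀ D₁ →
        -- independent samples with law `P`
        (∀ t, Measurable (ξ t)) → (∀ t, μ.map (ξ t) = P) → iIndepFun ξ μ →
        -- the hyper-parameters
        2 ≤ T → β₁ < √β₂ → √β₂ < 1 →
        0 < a → a < 2 → 0 < b → b < 2 → β₁ ^ (2 - a) ≤ β₂ ^ (1 + b) →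
        (√(D₃ β₁ β₂ η ρ L ε D₁ a b ^ 2 + 4 * D₃ β₁ β₂ η ρ L ε D₁ a b)
            - D₃ β₁ β₂ η ρ L ε D₁ a b) / 2 ≤ β₂ →
        1 - β₂ ≤ Cβ / T →
        cη / √(T : ℝ) ≤ η → η ≤ Cη / √(T : ℝ) →
        0 ≤ ρ → ρ ≤ Cρ / √(T : ℝ) →
        (∀ t < T, Integrable (fun ω => l1norm (gradient (objective F P)
            (weights F β₁ β₂ η ρ ε x₁ (fun k => ξ k ω) t))) μ) ∧
          (1 / (T : ℝ)) * ∑ t ∈ Finset.range T, ∫ ω, l1norm (gradient (objective F P)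
              (weights F β₁ β₂ η ρ ε x₁ (fun k => ξ k ω) t)) ∂μ
            ≤ K * (Real.log T / (T : ℝ) ^ (1 / 4 : ℝ)) := by
  -- `A` dominates every constant, the rescaling factors and the inverse momentum gap, without
  -- involving `T`, `β₂`, `η` or `ρ`. Absolute values are needed because `A` is fixed before the
  -- signs of these terms, `1 - β₁ ^ 2` included, are known.
  let A : ℝ := 1 + L + D₀ + D₁ + 1 / ε + ε ^ 2 + |Δ| + |Cβ| + |Cη| + |Cρ| + 1 / cη
    + Real.exp (4 / 3 * |Cβ|) + |2 * (1 + 1 / (256 * D₁)) / (1 - β₁ ^ 2)|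
  have hεi : 0 < 1 / ε := by positivity
  have hε2 : 0 < ε ^ 2 := by positivity
  have hci : 0 < 1 / cη := by positivity
  have hexp := Real.exp_pos (4 / 3 * |Cβ|)
  have hΔ0 := abs_nonneg Δ
  have hCβ0 := abs_nonneg Cβ
  have hCη0 := abs_nonneg Cη
  have hCρ0 := abs_nonneg Cρ
  have hgap0 := abs_nonneg (2 * (1 + 1 / (256 * D₁)) / (1 - β₁ ^ 2))
  have hA : 1 ≤ A := by linarith
  refine ⟨d * (2 * IsRandomPath.totalBound A) / Real.log 2, ?_⟩
  intro Ω _ μ _ Ξ _ P _ F x₁ ξ T β₂ η ρ a b hm hi hobj hF hN hξ hlaw hind hT hββ hβ1 _ _ _ _ _ hD₃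
    hα hη hη' hρ hρ'
  have hT0 : 0 < T := by omega
  have hTpos : (0 : ℝ) < T := by exact_mod_cast hT0
  have hsT : 0 < √(T : ℝ) := Real.sqrt_pos.2 hTpos
  have hsT2 : √(T : ℝ) ^ 2 = T := Real.sq_sqrt hTpos.le
  obtain ⟨hβ34, hgap⟩ := beta_bounds_of_D₃ hβ₁ hββ hβ1 hD₃
  have hβ₂ : β₂ < 1 := by
    have := (Real.sqrt_lt' one_pos).1 hβ1
    linarith
  have hβ0 : 0 < β₂ := by linarith
  set θ := 1 / √(T : ℝ) with hθ
  have hθ0 : 0 < θ := by positivity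
  have hθ1 : θ ≤ 1 := by
    rw [hθ, div_le_one hsT]
    exact Real.one_le_sqrt.2 (by exact_mod_cast hT0)
  have hθT : θ ^ 2 * T = 1 := by
    rw [hθ, div_pow, hsT2]; field_simp
  have hη1 : cη * θ ≤ η := by rw [hθ, mul_one_div]; exact hη
  have hscale : ∀ C c : ℝ, |C| ≤ A → c ≤ C / √(T : ℝ) → c ≤ A * θ := by
    intro C c hC hc
    calc c ≤ C * θ := by rw [hθ, mul_one_div]; exact hc
      _ ≤ A * θ := by
        gcongr
        exact (le_abs_self C).trans hC
  have hα' : 1 - β₂ ≤ A * θ ^ 2 := by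
    calc 1 - β₂ ≤ Cβ * θ ^ 2 := by
          rw [hθ, div_pow, hsT2, one_pow, mul_one_div]; exact hα
      _ ≤ A * θ ^ 2 := by
        gcongr
        linarith [le_abs_self Cβ]
  have hγA : 1 ≤ A * (1 - β₁ / √β₂) := by
    refine one_le_mul_momentum_gap hβ₁ hD₁ hββ hβ1 (by rwa [Real.sq_sqrt hβ0.le]) ?_
    linarith [le_abs_self (2 * (1 + 1 / (256 * D₁)) / (1 - β₁ ^ 2))]
  have hθη : θ ≤ A * η := by
    have h1 : θ ≤ 1 / cη * η := by
      rw [div_mul_eq_mul_div, one_mul, le_div_iff₀ hcη]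
      linarith
    have h2 : 0 ≤ η := le_trans (by positivity) hη1
    exact h1.trans (mul_le_mul_of_nonneg_right (by linarith) h2)
  -- `T ^ (1 / 4)` balances the two terms of `τ + θ * T / τ`, as `θ * T = √T`.
  set τ := (T : ℝ) ^ (1 / 4 : ℝ) with hτ
  have hτ0 : 0 < τ := Real.rpow_pos_of_pos hTpos _
  have hττ : τ * τ = √(T : ℝ) := by
    rw [hτ, ← Real.rpow_add hTpos, Real.sqrt_eq_rpow]; norm_num
  have key := fun l : Fin d => sum_expected_partial_le (x₁ := x₁) (P := P) (μ := μ) (β₂ := β₂)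
    (η := η) (ρ := ρ) (T := T) (ξ := ξ) (A := A) (θ := θ) (τ := τ) l hm hi hF hN
    (fun x => (hobj x).trans (by linarith [le_abs_self Δ])) hξ hlaw hind hL hD₀ hD₁ hε hβ₁
    hβ₂.le hββ (le_trans (by positivity) hη1) hρ hA (by linarith) (by linarith) (by linarith)
    (by linarith) (by linarith) hγA
    (fun t ht => one_div_sqrt_pow_le hβ34 hβ₂ hT0 hα (by linarith) ht)
    hθ0.le hθ1 hθT.le (hscale _ _ (by linarith) hη') (hscale _ _ (by linarith) hρ') hθη hα' hτ0
  have hint : ∀ t < T, ∀ l ∈ (Finset.univ : Finset (Fin d)),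
      Integrable (fun ω => |gradient (objective F P)
        (weights F β₁ β₂ η ρ ε x₁ (fun k => ξ k ω) t) l|) μ := fun t ht l _ => (key l).1 t ht
  refine ⟨fun t ht => integrable_finsetSum _ (hint t ht), ?_⟩
  have hsum : ∑ t ∈ Finset.range T, ∫ ω, l1norm (gradient (objective F P)
        (weights F β₁ β₂ η ρ ε x₁ (fun k => ξ k ω) t)) ∂μ
      = ∑ l : Fin d, ∑ t ∈ Finset.range T, ∫ ω, |gradient (objective F P)
        (weights F β₁ β₂ η ρ ε x₁ (fun k => ξ k ω) t) l| ∂μ := by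
    rw [Finset.sum_comm]
    exact Finset.sum_congr rfl fun t ht =>
      integral_finsetSum _ (hint t (Finset.mem_range.1 ht))
  have hbound : θ * ∑ t ∈ Finset.range T, ∫ ω, l1norm (gradient (objective F P)
        (weights F β₁ β₂ η ρ ε x₁ (fun k => ξ k ω) t)) ∂μ
      ≤ d * (2 * IsRandomPath.totalBound A) * τ := by
    rw [hsum, Finset.mul_sum]
    calc _ ≤ ∑ _l : Fin d, IsRandomPath.totalBound A * (τ + θ * T / τ) :=
          Finset.sum_le_sum fun l _ => (key l).2
      _ = d * (2 * IsRandomPath.totalBound A) * τ := by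
          have e : θ * T / τ = τ := by
            rw [div_eq_iff hτ0.ne', hττ, hθ, one_div_mul_eq_div, Real.div_sqrt]
          rw [e, Finset.sum_const, Finset.card_univ, Fintype.card_fin, nsmul_eq_mul]
          ring
  have hB : 0 ≤ IsRandomPath.totalBound A := by
    have : 0 ≤ A := by linarith
    unfold IsRandomPath.totalBound
    positivity
  have hlog2 : 0 < Real.log 2 := Real.log_pos one_lt_two
  -- The bound without logarithm is already at hand; `T ≥ 2` allows the factor `log T / log 2 ≥ 1`
  -- to be inserted.
  have hlog : 1 ≤ Real.log T / Real.log 2 := by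
    rw [one_le_div hlog2]
    exact Real.log_le_log two_pos (by exact_mod_cast hT)
  have hθτ : θ * (τ * τ) = 1 := by rw [hττ, hθ]; field_simp
  have e1 : (1 : ℝ) / T = θ * θ := by
    field_simp
    linarith
  calc _ = θ * (θ * ∑ t ∈ Finset.range T, ∫ ω, l1norm (gradient (objective F P)
        (weights F β₁ β₂ η ρ ε x₁ (fun k => ξ k ω) t)) ∂μ) := by rw [e1]; ring
    _ ≤ θ * (d * (2 * IsRandomPath.totalBound A) * τ) := by gcongr
    _ = d * (2 * IsRandomPath.totalBound A) * (θ * (τ * τ)) / τ := by field_simp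
    _ = d * (2 * IsRandomPath.totalBound A) / τ * 1 := by rw [hθτ]; ring
    _ ≤ d * (2 * IsRandomPath.totalBound A) / τ * (Real.log T / Real.log 2) := by gcongr
    _ = _ := by ring
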